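/- **Setting.** Let $S$ and $A$ be Borel spaces (state and action space), with an isolated point $x_\infty$ adjoined to $S$ and $a_\infty$ to $A$. Given are: - admissible action sets $A(x)\subseteq A$, $x\in S$, such that $K=\{(x,a):a\in A(x)\}$ is measurable and contains the graph of a measurable map $S\to A$; put $A(x_\infty)=\{a_\infty\}$; - a signed kernel $q(dy|x,a)$ on $S$ given $(x,a)\in K$ (finite signed measures), with $q(\Gamma|x,a)\ge 0$ whenever $x\notin\Gamma$, $q(S|x,a)=0$ and $\bar q_x=\sup_{a\in A(x)}q_x(a)<\infty$, where $q_x(a)=-q(\{x\}|x,a)$; - a measurable cost rate $c_0:K\to\mathbb R$. The sample space $\Omega$ consists of the sequences $\omega=(x_0,\theta_1,x_1,\theta_2,x_2,\dots)$ with $x_0\in S$ in which either all $(\theta_m,x_m)\in(0,\infty)\times S$, or this holds up to some index and all later $(\theta_m,x_m)$ equal $(\infty,x_\infty)$; it carries the trace of the product $\sigma$-algebra. Put $h_m=(x_0,\theta_1,\dots,\theta_m,x_m)$, $T_0=0$, $T_m=\theta_1+\dots+\theta_m$, $T_\infty=\lim_m T_m$, $\xi_t=x_m$ for $T_m\le t<T_{m+1}$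 and $\xi_t=x_\infty$ for $t\ge T_\infty$; $\xi_{t-}=x_m$ for $T_m<t\le T_{m+1}$, $\xi_{0-}=x_0$, and $\xi_{t-}=x_\infty$ for $t\ge T_\infty$. Let $\mathcal F_t$ be the $\sigma$-algebra generated by the events $\{T_m\le s,\ x_m\in\Gamma\}$, $s\le t$, $m\ge0$, $\Gamma\in\mathcal B(S)$, let $\mathcal F_{s-}=\bigvee_{t<s}\mathcal F_t$, and let $\mathcal P$ be the predictable $\sigma$-algebra on $\Omega\times[0,\infty)$, generated by the sets $\Gamma\times\{0\}$ ($\Gamma\in\mathcal F_0$) and $\Gamma\times(s,\infty)$ ($\Gamma\in\mathcal F_{s-}$, $s\ge0$). A (randomized history-dependent) policy $\pi$ is a $\mathcal P$-measurable transition probability $\pi(da|\omega,t)$ on $A\cup\{a_\infty\}$ concentrated on $A(\xi_{t-})$. For $T_m<t\le T_{m+1}$ it depends on $\omega$ through $h_m$ only; put $$\Lambda^m(\Gamma|h_m,u)=\int_A\pi(da|h_m,T_m+u)\,q(\Gamma\setminus\{x_m\}|x_m,a).$$ For a probability measure $\gamma$ on $S$, $P^\pi_\gamma$ is the probability measure on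 $\Omega$ under which $x_0$ has the law $\gamma$ and, given $h_m$, the pair $(\theta_{m+1},x_{m+1})$ equals $(\infty,x_\infty)$ if $\theta_m=\infty$ (with $m\ge1$), and otherwise has the law $\Lambda^m(dy|h_m,u)\,e^{-\int_0^u\Lambda^m(S|h_m,v)dv}\,du$ on $(0,\infty)\times S$ together with the mass $e^{-\int_0^\infty\Lambda^m(S|h_m,v)dv}$ at $(\infty,x_\infty)$. Write $P^\pi_x$ for $\gamma=\delta_x$, and $E^\pi_\gamma,E^\pi_x$ for the expectations. **Condition 1.** $w:S\to[1,\infty)$ is measurable, $\rho\ge0$, $b\ge0$, and $S_0\subseteq S_1\subseteq\cdots$ are measurable subsets of $S$ with: (a) $\bigcup_l S_l=S$ and $\lim_{l\to\infty}\inf_{x\in S\setminus S_l}w(x)=\infty$ (with $\inf\emptyset=\infty$); (b) $\int_S q(dy|x,a)w(y)\le\rho w(x)+b$ for all $x\in S$, $a\in A(x)$; (c) $\sup_{x\in S_l}\bar q_x<\infty$ for every $l$. **Condition 2** (for $\gamma$, $\alpha$, $M$, $c$). (a) $\int_S w\,d\gamma<\infty$; (b) $\alpha>\rho$; (c) $M\ge0$,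 $c\ge0$ and $|\inf_{a\in A(x)}c_0(x,a)|\le Mw(x)+c$ for all $x\in S$. **Theorem.** Suppose Condition 1 holds, and let $\pi$ be any policy. (a) For every initial distribution $\gamma$, $P^\pi_\gamma(T_\infty=\infty)=1$, and hence $P^\pi_\gamma(\xi_t\in S)=1$ for all $t\ge0$. Moreover, for all $x\in S$ and $t\ge0$, $$E^\pi_x[w(\xi_t)]\le e^{\rho t}w(x)+\frac b\rho\,(e^{\rho t}-1),$$ where for $\rho=0$ the right-hand side is read as its limit $w(x)+bt$. (b) If in addition Condition 2 holds for an initial distribution $\gamma$, a discount factor $\alpha$ and constants $M,c$, then $$V_0(\pi):=E^\pi_\gamma\Big[\int_0^\infty e^{-\alpha t}\int_A c_0(\xi_{t-},a)\,\pi(da|\omega,t)\,dt\Big]\ \ge\ -\frac{M\big(\alpha\int_S w\,d\gamma+b\big)}{\alpha(\alpha-\rho)}-\frac c\alpha\ >\ -\infty .$$ -/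

import Mathlib

open MeasureTheory ProbabilityTheory Filter Topology
open scoped ENNReal NNReal

noncomputable section

/-- The primitives of a controlled continuous-time jump model with state space `S` and action
space `A`. Only the values of `q` and `cost` at admissible pairs are constrained or used. -/
structure CTMDP (S A : Type*) [MeasurableSpace S] [MeasurableSpace A] where
  /-- the set `A(x)` of admissible actions at `x` -/
  adm : S → Set A
  /-- the set `K` of admissible pairs is measurable -/
  measurableSet_graph : MeasurableSet {p : S × A | p.2 ∈ adm p.1}
  /-- `K` contains the graph of a measurable map -/
  exists_selector : ∃ φ : S → A, Measurable φ ∧ ∀ x, φ x ∈ adm x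
  /-- the transition rate `q(dy | x, a)`, a signed kernel given `(x, a) ∈ K` -/
  q : S → A → SignedMeasure S
  measurable_q : ∀ Γ : Set S, MeasurableSet Γ →
    Measurable fun p : {p : S × A | p.2 ∈ adm p.1} => q p.1.1 p.1.2 Γ
  q_nonneg : ∀ x, ∀ a ∈ adm x, ∀ Γ : Set S, MeasurableSet Γ → x ∉ Γ → 0 ≤ q x a Γ
  /-- conservativeness -/
  q_univ : ∀ x, ∀ a ∈ adm x, q x a Set.univ = 0
  /-- stability: the total jump rates at `x` are bounded over `A(x)` -/
  q_stable : ∀ x, (⨆ a ∈ adm x, ENNReal.ofReal (-q x a {x})) < ⊤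
  /-- the cost rate `c₀` -/
  cost : S → A → ℝ
  measurable_cost : Measurable fun p : {p : S × A | p.2 ∈ adm p.1} => cost p.1.1 p.1.2


namespace CTMDP

variable {S A : Type*} [MeasurableSpace S] [MeasurableSpace A]

/-- The supremum over `A(x)` of the total jump rates `q_x(a) = -q({x} | x, a)`. -/
def maxRate (M : CTMDP S A) (x : S) : ℝ≥0∞ := ⨆ a ∈ M.adm x, ENNReal.ofReal (-M.q x a {x})

/-! ### Sample paths

An isolated point `Sum.inr ()` is adjoined to `S` and to `A`. -/

/-- The sequences `(θ₀, x₀), (θ₁, x₁), …` that make up the sample space, where `θ₀ = 0` is a dummy: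
`x₀ ∈ S`, the sojourn times `θ₁, θ₂, …` are positive, and as soon as one of them is infinite,
all later entries are `(∞, x_∞)`. -/
def IsPath (ω : ℕ → ℝ≥0∞ × (S ⊕ Unit)) : Prop :=
  (ω 0).1 = 0 ∧ (ω 0).2 ∈ Set.range Sum.inl ∧
    ∀ m, 0 < (ω (m + 1)).1 ∧ ((ω (m + 1)).1 = ⊤ ↔ (ω (m + 1)).2 = Sum.inr ()) ∧
      ((ω m).1 = ⊤ → (ω (m + 1)).1 = ⊤)

/-- The sample space, with the trace of the product σ-algebra. -/
abbrev Path (S : Type*) : Type _ := {ω : ℕ → ℝ≥0∞ × (S ⊕ Unit) // IsPath ω}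

/-- The sojourn time `θ_m`. -/
def sojourn (m : ℕ) (ω : Path S) : ℝ≥0∞ := (ω.1 m).1

/-- The post-jump state `x_m`. -/
def mark (m : ℕ) (ω : Path S) : S ⊕ Unit := (ω.1 m).2

/-- The jump moment `T_m = θ₁ + ⋯ + θ_m`. -/
def jumpTime (m : ℕ) (ω : Path S) : ℝ≥0∞ := ∑ i ∈ Finset.range (m + 1), sojourn i ω

/-- The explosion time `T_∞ = lim T_m`. -/
def explosionTime (ω : Path S) : ℝ≥0∞ := ⨆ m, jumpTime m ω

open Classical in
/-- The process `ξ_t`, equal to `x_m` for `T_m ≤ t < T_{m+1}` and to `x_∞` for `t ≥ T_∞`. -/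
def state (t : ℝ≥0) (ω : Path S) : S ⊕ Unit :=
  if h : ∃ m, jumpTime m ω ≤ t ∧ (t : ℝ≥0∞) < jumpTime (m + 1) ω then mark h.choose ω
  else Sum.inr ()

open Classical in
/-- The left limit `ξ_{t-}`, equal to `x_m` for `T_m < t ≤ T_{m+1}`, to `x₀` for `t = 0` and to
`x_∞` for `t ≥ T_∞`. -/
def leftState (t : ℝ≥0) (ω : Path S) : S ⊕ Unit :=
  if t = 0 then mark 0 ω
  else if h : ∃ m, jumpTime m ω < t ∧ (t : ℝ≥0∞) ≤ jumpTime (m + 1) ω then mark h.choose ω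
  else Sum.inr ()

/-- The history `ℱ_t` generated by the events `{T_m ≤ s, x_m ∈ Γ}` with `s ≤ t`. -/
abbrev history (S : Type*) [MeasurableSpace S] (t : ℝ≥0) : MeasurableSpace (Path S) :=
  MeasurableSpace.generateFrom {E | ∃ m : ℕ, ∃ s ≤ t, ∃ Γ : Set S, MeasurableSet Γ ∧
    E = {ω | jumpTime m ω ≤ (s : ℝ≥0∞) ∧ mark m ω ∈ Sum.inl '' Γ}}

/-- The σ-algebra `ℱ_{s-}` generated by all `ℱ_t` with `t < s`. -/
abbrev historyBefore (S : Type*) [MeasurableSpace S] (s : ℝ≥0) : MeasurableSpace (Path S) :=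
  ⨆ t : ℝ≥0, ⨆ _ : t < s, history S t

/-- The predictable σ-algebra on `Ω × [0, ∞)`. -/
abbrev predictable (S : Type*) [MeasurableSpace S] : MeasurableSpace (Path S × ℝ≥0) :=
  MeasurableSpace.generateFrom
    ({E | ∃ Γ : Set (Path S), MeasurableSet[history S 0] Γ ∧ E = Γ ×ˢ {0}} ∪
      {E | ∃ (s : ℝ≥0) (Γ : Set (Path S)), MeasurableSet[historyBefore S s] Γ ∧
        E = Γ ×ˢ Set.Ioi s})

/-- Admissible actions on the extended spaces, with `A(x_∞) = {a_∞}`. -/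
def extAdm (M : CTMDP S A) : S ⊕ Unit → Set (A ⊕ Unit)
  | Sum.inl x => Sum.inl '' M.adm x
  | Sum.inr _ => {Sum.inr ()}

/-- Randomized history-dependent policies: predictable transition probabilities `π(da | ω, t)`
that are concentrated on `A(ξ_{t-})`. -/
structure Policy (M : CTMDP S A) where
  toFun : Path S → ℝ≥0 → Measure (A ⊕ Unit)
  measurable_toFun :
    Measurable[predictable S] fun p : Path S × ℝ≥0 => toFun p.1 p.2
  isProbabilityMeasure : ∀ ω t, IsProbabilityMeasure (toFun ω t)
  concentrated : ∀ ω t, toFun ω t (M.extAdm (leftState t ω))ᶜ = 0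

/-- The path that follows `ω` up to and including its `k`-th jump and then stays put. -/
def freeze (k : ℕ) (ω : Path S) : Path S :=
  ⟨fun i => if i ≤ k then ω.1 i else (⊤, Sum.inr ()), by
    obtain ⟨h0, h1, h2⟩ := ω.2
    refine ⟨by simpa using h0, by simpa using h1, fun m => ?_⟩
    by_cases hm : m + 1 ≤ k
    · have hm' : m ≤ k := by omega
      simpa [hm, hm'] using h2 m
    · simp [hm]⟩

/-! ### Measurability of the path functionals -/

theorem measurableSet_isPath : MeasurableSet {ω : ℕ → ℝ≥0∞ × (S ⊕ Unit) | IsPath ω} := by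
  have h1 : ∀ m, Measurable fun ω : ℕ → ℝ≥0∞ × (S ⊕ Unit) => (ω m).1 := fun m => by fun_prop
  have h2 : ∀ m, Measurable fun ω : ℕ → ℝ≥0∞ × (S ⊕ Unit) => (ω m).2 := fun m => by fun_prop
  have htop : ∀ m, MeasurableSet {ω : ℕ → ℝ≥0∞ × (S ⊕ Unit) | (ω m).1 = ⊤} := fun m =>
    h1 m (measurableSet_singleton ⊤)
  have hinr : ∀ m, MeasurableSet {ω : ℕ → ℝ≥0∞ × (S ⊕ Unit) | (ω m).2 = Sum.inr ()} := fun m => by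
    have : MeasurableSet ({Sum.inr ()} : Set (S ⊕ Unit)) := by
      simpa using (measurableSet_inr_image (α := S)).2 (measurableSet_singleton ())
    exact h2 m this
  refine MeasurableSet.inter (h1 0 (measurableSet_singleton 0))
    (MeasurableSet.inter (h2 0 measurableSet_range_inl) ?_)
  have : {ω : ℕ → ℝ≥0∞ × (S ⊕ Unit) | ∀ m, 0 < (ω (m + 1)).1 ∧
      ((ω (m + 1)).1 = ⊤ ↔ (ω (m + 1)).2 = Sum.inr ()) ∧ ((ω m).1 = ⊤ → (ω (m + 1)).1 = ⊤)} =
      ⋂ m, {ω | 0 < (ω (m + 1)).1 ∧ ((ω (m + 1)).1 = ⊤ ↔ (ω (m + 1)).2 = Sum.inr ()) ∧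
        ((ω m).1 = ⊤ → (ω (m + 1)).1 = ⊤)} := by
    ext ω; simp
  change MeasurableSet {ω : ℕ → ℝ≥0∞ × (S ⊕ Unit) | ∀ m, 0 < (ω (m + 1)).1 ∧
      ((ω (m + 1)).1 = ⊤ ↔ (ω (m + 1)).2 = Sum.inr ()) ∧ ((ω m).1 = ⊤ → (ω (m + 1)).1 = ⊤)}
  rw [this]
  refine MeasurableSet.iInter fun m => ?_
  refine MeasurableSet.inter (h1 (m + 1) measurableSet_Ioi)
    (MeasurableSet.inter ((htop _).iff (hinr _)) ((htop _).imp (htop _)))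

theorem measurable_sojourn (m : ℕ) : Measurable (sojourn m : Path S → ℝ≥0∞) :=
  ((measurable_pi_apply m).comp measurable_subtype_coe).fst

theorem measurable_mark (m : ℕ) : Measurable (mark m : Path S → S ⊕ Unit) :=
  ((measurable_pi_apply m).comp measurable_subtype_coe).snd

theorem measurable_jumpTime (m : ℕ) : Measurable (jumpTime m : Path S → ℝ≥0∞) :=
  Finset.measurable_fun_sum _ fun i _ => measurable_sojourn i

theorem measurable_freeze (k : ℕ) : Measurable (freeze k : Path S → Path S) := by
  refine Measurable.subtype_mk (measurable_pi_lambda _ fun i => ?_)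
  by_cases hi : i ≤ k
  · simp only [hi, if_true]
    exact (measurable_pi_apply i).comp measurable_subtype_coe
  · simpa only [hi, if_false] using measurable_const

theorem history_le (t : ℝ≥0) : history S t ≤ (inferInstance : MeasurableSpace (Path S)) := by
  refine MeasurableSpace.generateFrom_le ?_
  rintro _ ⟨m, s, -, Γ, hΓ, rfl⟩
  exact MeasurableSet.inter (measurable_jumpTime m measurableSet_Iic)
    (measurable_mark m (measurableSet_inl_image.2 hΓ))

theorem predictable_le :
    predictable S ≤ (inferInstance : MeasurableSpace (Path S × ℝ≥0)) := by
  refine MeasurableSpace.generateFrom_le ?_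
  rintro _ (⟨Γ, hΓ, rfl⟩ | ⟨s, Γ, hΓ, rfl⟩)
  · exact (history_le 0 _ hΓ).prod (measurableSet_singleton 0)
  · refine MeasurableSet.prod ?_ measurableSet_Ioi
    exact (iSup₂_le fun t _ => history_le t : historyBefore S s ≤ _) _ hΓ

theorem Policy.measurable {M : CTMDP S A} (π : M.Policy) :
    Measurable fun p : Path S × ℝ≥0 => π.toFun p.1 p.2 :=
  π.measurable_toFun.mono predictable_le le_rfl

/-! ### Jump intensities -/

theorem integral_mul_exp_neg_integral (f : ℝ → ℝ) (C : ℝ) (hf : Measurable f) (h0 : ∀ u, 0 ≤ f u)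
    (hC : ∀ u, f u ≤ C) (t : ℝ) (ht : 0 ≤ t) :
    ∫ u in (0)..t, f u * Real.exp (-∫ v in (0)..u, f v) = 1 - Real.exp (-∫ v in (0)..t, f v) := by
  have hint : ∀ a b, IntervalIntegrable f volume a b := fun a b => by
    refine (intervalIntegrable_const (c := C)).mono_fun hf.aestronglyMeasurable ?_
    filter_upwards with u
    rw [Real.norm_of_nonneg (h0 u)]
    exact (hC u).trans (le_abs_self C)
  set F : ℝ → ℝ := fun u => ∫ v in (0)..u, f v with hF
  have hF0 : ∀ u, 0 ≤ u → 0 ≤ F u := fun u hu =>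
    intervalIntegral.integral_nonneg hu fun v _ => h0 v
  have hC0 : 0 ≤ C := (h0 0).trans (hC 0)
  have hexp : ∀ a b : ℝ, 0 ≤ a → 0 ≤ b → |Real.exp (-a) - Real.exp (-b)| ≤ |a - b| := by
    have key : ∀ a b : ℝ, 0 ≤ a → a ≤ b → Real.exp (-a) - Real.exp (-b) ≤ b - a := by
      intro a b ha hab
      have h1 : Real.exp (-b) = Real.exp (-a) * Real.exp (-(b - a)) := by
        rw [← Real.exp_add]; ring_nf
      have h2 : Real.exp (-a) ≤ 1 := Real.exp_le_one_iff.2 (by linarith)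
      have h3 := Real.add_one_le_exp (-(b - a))
      have h4 := Real.exp_pos (-a)
      rw [h1]
      nlinarith
    intro a b ha hb
    rcases le_total a b with h | h
    · rw [abs_of_nonneg (by simpa using h), abs_of_nonpos (by linarith)]
      linarith [key a b ha h]
    · rw [abs_of_nonpos (by simpa using h), abs_of_nonneg (by linarith)]
      linarith [key b a hb h]
  have hlip : LipschitzOnWith C.toNNReal (fun u => Real.exp (-F u)) (Set.uIcc 0 t) := by
    rw [Set.uIcc_of_le ht]
    refine LipschitzOnWith.of_dist_le_mul fun u hu v hv => ?_
    rw [Real.dist_eq, Real.dist_eq, Real.coe_toNNReal C hC0]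
    refine (hexp _ _ (hF0 u hu.1) (hF0 v hv.1)).trans ?_
    have : F u - F v = ∫ s in v..u, f s :=
      intervalIntegral.integral_interval_sub_left (hint _ _) (hint _ _)
    rw [this]
    refine intervalIntegral.norm_integral_le_of_norm_le_const (f := f) fun s _ => ?_
    rw [Real.norm_of_nonneg (h0 s)]
    exact hC s
  have hftc := hlip.absolutelyContinuousOnInterval.integral_deriv_eq_sub
  have hae := (hint 0 t).ae_hasDerivAt_integral
  have hcongr : ∫ u in (0)..t, deriv (fun u => Real.exp (-F u)) u =
      ∫ u in (0)..t, -(f u * Real.exp (-F u)) := by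
    refine intervalIntegral.integral_congr_ae ?_
    filter_upwards [hae] with u hu hmem
    have h1 : HasDerivAt F (f u) u := hu (Set.uIoc_subset_uIcc hmem) 0 Set.left_mem_uIcc
    have h2 : HasDerivAt (fun u => Real.exp (-F u)) (Real.exp (-F u) * -f u) u := h1.neg.exp
    rw [h2.deriv]
    ring
  rw [hcongr, intervalIntegral.integral_neg] at hftc
  have : F 0 = 0 := by simp [hF]
  rw [this] at hftc
  simp only [neg_zero, Real.exp_zero] at hftc
  linarith

theorem lintegral_exp_neg_add_exp_neg (g : ℝ → ℝ≥0∞) (hg : Measurable g) (C : ℝ≥0∞) (hC : C < ⊤)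
    (hle : ∀ u, g u ≤ C) :
    (∫⁻ u in Set.Ioi (0 : ℝ),
        EReal.exp (-((∫⁻ v in Set.Ioc 0 u, g v : ℝ≥0∞) : EReal)) * g u) +
      EReal.exp (-((∫⁻ v in Set.Ioi 0, g v : ℝ≥0∞) : EReal)) = 1 := by
  have hgt : ∀ u, g u ≠ ⊤ := fun u => ((hle u).trans_lt hC).ne
  let f : ℝ → ℝ := fun u => (g u).toReal
  have hf : Measurable f := hg.ennreal_toReal
  have hgf : ∀ u, g u = ENNReal.ofReal (f u) := fun u => (ENNReal.ofReal_toReal (hgt u)).symm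
  have h0 : ∀ u, 0 ≤ f u := fun u => ENNReal.toReal_nonneg
  have hfC : ∀ u, f u ≤ C.toReal := fun u => ENNReal.toReal_mono hC.ne (hle u)
  have hint : ∀ a b, IntervalIntegrable f volume a b := fun a b => by
    refine (intervalIntegrable_const (c := C.toReal)).mono_fun hf.aestronglyMeasurable ?_
    filter_upwards with u
    rw [Real.norm_of_nonneg (h0 u)]
    exact (hfC u).trans (le_abs_self _)
  have hG : ∀ u, 0 ≤ u → ∫⁻ v in Set.Ioc 0 u, g v = ENNReal.ofReal (∫ v in (0)..u, f v) := by
    intro u hu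
    rw [intervalIntegral.integral_of_le hu, ofReal_integral_eq_lintegral_ofReal (hint 0 u).1
      (ae_of_all _ h0)]
    simp_rw [hgf]
  have hE : ∀ u, 0 ≤ u → EReal.exp (-((∫⁻ v in Set.Ioc 0 u, g v : ℝ≥0∞) : EReal)) =
      ENNReal.ofReal (Real.exp (-∫ v in (0)..u, f v)) := by
    intro u hu
    rw [hG u hu, EReal.coe_ennreal_ofReal,
      max_eq_left (intervalIntegral.integral_nonneg hu fun v _ => h0 v), ← EReal.coe_neg,
      EReal.exp_coe]
  have hunion : Set.Ioi (0 : ℝ) = ⋃ n : ℕ, Set.Ioc (0 : ℝ) n := by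
    ext u
    simp only [Set.mem_Ioi, Set.mem_iUnion, Set.mem_Ioc]
    exact ⟨fun h => (exists_nat_ge u).imp fun n hn => ⟨h, hn⟩, fun ⟨n, h, _⟩ => h⟩
  have hmono : Monotone fun n : ℕ => Set.Ioc (0 : ℝ) n := fun m n h =>
    Set.Ioc_subset_Ioc_right (by exact_mod_cast h)
  have hlim : ∀ k : ℝ → ℝ≥0∞, Tendsto (fun n : ℕ => ∫⁻ u in Set.Ioc (0 : ℝ) n, k u) atTop
      (𝓝 (∫⁻ u in Set.Ioi (0 : ℝ), k u)) := by
    intro k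
    have h := tendsto_measure_iUnion_atTop (μ := volume.withDensity k) hmono
    rw [← hunion, withDensity_apply _ measurableSet_Ioi] at h
    refine h.congr fun n => ?_
    simp [withDensity_apply _ measurableSet_Ioc]
  have hcont : Continuous EReal.exp := EReal.expHomeomorph.continuous
  have h1 := (hlim fun u => EReal.exp (-((∫⁻ v in Set.Ioc 0 u, g v : ℝ≥0∞) : EReal)) * g u).add
    ((hcont.tendsto _).comp
      ((continuous_neg.tendsto _).comp ((continuous_coe_ennreal_ereal.tendsto _).comp (hlim g))))
  refine tendsto_nhds_unique h1 (tendsto_const_nhds.congr fun n => ?_)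
  have hn : (0 : ℝ) ≤ n := Nat.cast_nonneg n
  have hX : ∀ u, 0 ≤ u → 0 ≤ ∫ v in (0)..u, f v := fun u hu =>
    intervalIntegral.integral_nonneg hu fun v _ => h0 v
  have hcF : Continuous fun u => ∫ v in (0)..u, f v := intervalIntegral.continuous_primitive hint 0
  have hI : ∫⁻ u in Set.Ioc (0 : ℝ) n,
      EReal.exp (-((∫⁻ v in Set.Ioc 0 u, g v : ℝ≥0∞) : EReal)) * g u =
      ENNReal.ofReal (1 - Real.exp (-∫ v in (0)..(n : ℝ), f v)) := by
    rw [← integral_mul_exp_neg_integral f C.toReal hf h0 hfC n hn,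
      intervalIntegral.integral_of_le hn, ofReal_integral_eq_lintegral_ofReal]
    · refine setLIntegral_congr_fun measurableSet_Ioc fun u hu => ?_
      rw [hE u hu.1.le, hgf u, ← ENNReal.ofReal_mul (Real.exp_pos _).le, mul_comm]
    · exact ((hint 0 n).mul_continuousOn (by fun_prop)).1
    · exact ae_of_all _ fun u => mul_nonneg (h0 u) (Real.exp_pos _).le
  simp only [Function.comp_apply]
  rw [hI, hE n hn, ← ENNReal.ofReal_add _ (Real.exp_pos _).le]
  · simp
  · have := Real.exp_le_one_iff.2 (neg_nonpos.2 (hX n hn))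
    linarith

section Intensity

variable [StandardBorelSpace S]

theorem restrict_q_nonneg (M : CTMDP S A) {x : S} {a : A} (ha : a ∈ M.adm x) :
    0 ≤[({x} : Set S)ᶜ] M.q x a :=
  VectorMeasure.restrict_le_restrict_of_subset_le _ _ fun Γ hΓ hx => by
    simpa using M.q_nonneg x a ha Γ hΓ fun h => hx h rfl

open Classical in
/-- The measure `Γ ↦ q(Γ \ {x} | x, a)` for `(x, a) ∈ K`, extended by zero. -/
def jumpMeasure (M : CTMDP S A) : S ⊕ Unit → A ⊕ Unit → Measure S
  | Sum.inl x, Sum.inl a =>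
    if ha : a ∈ M.adm x then
      (M.q x a).toMeasureOfZeroLE {x}ᶜ (MeasurableSet.singleton x).compl (M.restrict_q_nonneg ha)
    else 0
  | _, _ => 0

theorem jumpMeasure_apply (M : CTMDP S A) {x : S} {a : A} (ha : a ∈ M.adm x) {Γ : Set S}
    (hΓ : MeasurableSet Γ) :
    M.jumpMeasure (Sum.inl x) (Sum.inl a) Γ = ENNReal.ofReal (M.q x a (Γ \ {x})) := by
  rw [jumpMeasure, dif_pos ha, SignedMeasure.toMeasureOfZeroLE_apply _ _ _ hΓ, Set.sdiff_eq,
    Set.inter_comm Γ]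
  exact (ENNReal.ofReal_eq_coe_nnreal _).symm

theorem jumpMeasure_univ_le (M : CTMDP S A) (x : S) (a : A ⊕ Unit) :
    M.jumpMeasure (Sum.inl x) a Set.univ ≤ M.maxRate x := by
  rcases a with a | a
  · by_cases ha : a ∈ M.adm x
    · rw [M.jumpMeasure_apply ha MeasurableSet.univ]
      have h : M.q x a (Set.univ \ {x}) = -M.q x a {x} := by
        have := VectorMeasure.of_add_of_sdiff (v := M.q x a) (MeasurableSet.singleton x)
          MeasurableSet.univ (Set.subset_univ _)
        rw [M.q_univ x a ha] at this
        linarith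
      rw [h]
      exact le_iSup₂ (f := fun a (_ : a ∈ M.adm x) => ENNReal.ofReal (-M.q x a {x})) a ha
    · simp [jumpMeasure, ha]
  · simp [jumpMeasure]

theorem measurable_q_section (M : CTMDP S A)
    {E : Set ({p : S × A | p.2 ∈ M.adm p.1} × S)} (hE : MeasurableSet E) :
    Measurable fun p : {p : S × A | p.2 ∈ M.adm p.1} => M.q p.1.1 p.1.2 (Prod.mk p ⁻¹' E) := by
  induction E, hE using MeasurableSpace.induction_on_inter generateFrom_prod.symm isPiSystem_prod with
  | empty => simp
  | basic E hE =>
    obtain ⟨s, hs, t, ht, rfl⟩ := hE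
    classical
    have : (fun p : {p : S × A | p.2 ∈ M.adm p.1} => M.q p.1.1 p.1.2 (Prod.mk p ⁻¹' s ×ˢ t)) =
        fun p => if p ∈ s then M.q p.1.1 p.1.2 t else 0 := by
      funext p
      by_cases hp : p ∈ s <;> simp [hp]
    rw [this]
    exact Measurable.ite hs (M.measurable_q t ht) measurable_const
  | compl E hE ih =>
    have : (fun p : {p : S × A | p.2 ∈ M.adm p.1} => M.q p.1.1 p.1.2 (Prod.mk p ⁻¹' Eᶜ)) =
        fun p => -M.q p.1.1 p.1.2 (Prod.mk p ⁻¹' E) := by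
      funext p
      have h := VectorMeasure.of_add_of_sdiff (v := M.q p.1.1 p.1.2) (measurable_prodMk_left hE)
        MeasurableSet.univ (Set.subset_univ (Prod.mk p ⁻¹' E))
      rw [M.q_univ _ _ p.2, ← Set.compl_eq_univ_sdiff] at h
      rw [Set.preimage_compl]
      linarith
    rw [this]
    exact ih.neg
  | iUnion f hd hf ih =>
    refine measurable_of_tendsto_metrizable
      (f := fun n p => ∑ i ∈ Finset.range n, M.q p.1.1 p.1.2 (Prod.mk p ⁻¹' f i))
      (fun n => Finset.measurable_fun_sum _ fun i _ => ih i) ?_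
    rw [tendsto_pi_nhds]
    intro p
    rw [Set.preimage_iUnion]
    exact ((M.q p.1.1 p.1.2).hasSum_of_disjoint_iUnion (fun i => measurable_prodMk_left (hf i))
      fun i j hij => (hd hij).preimage _).tendsto_sum_nat

theorem measurable_jumpMeasure (M : CTMDP S A) :
    Measurable fun p : (S ⊕ Unit) × (A ⊕ Unit) => M.jumpMeasure p.1 p.2 := by
  classical
  refine Measure.measurable_of_measurable_coe _ fun Γ hΓ => ?_
  let K : Set (S × A) := {p | p.2 ∈ M.adm p.1}
  have h1 : Measurable fun p : K => ENNReal.ofReal (M.q p.1.1 p.1.2 (Γ \ {p.1.1})) := by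
    have hE : MeasurableSet {z : K × S | z.2 ∈ Γ ∧ ¬z.2 = z.1.1.1} :=
      MeasurableSet.inter (measurable_snd hΓ)
        (measurableSet_eq_fun (f := fun z : K × S => z.2) (g := fun z : K × S => z.1.1.1)
          (by fun_prop) (by fun_prop)).compl
    exact (M.measurable_q_section hE).ennreal_ofReal
  have h2 : Measurable fun p : S × A => M.jumpMeasure (Sum.inl p.1) (Sum.inl p.2) Γ := by
    have := Measurable.dite (s := K) h1 (g := fun _ => (0 : ℝ≥0∞)) measurable_const
      M.measurableSet_graph
    convert this using 2 with p
    by_cases hp : p ∈ K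
    · rw [dif_pos hp, M.jumpMeasure_apply hp hΓ]
    · rw [dif_neg hp, jumpMeasure, dif_neg (show p.2 ∉ M.adm p.1 from hp)]
      simp
  have h3 : Measurable ((fun p : (S ⊕ Unit) × (A ⊕ Unit) => M.jumpMeasure p.1 p.2 Γ) ∘
      (MeasurableEquiv.sumProdSum S Unit A Unit).symm) :=
    measurable_fun_sum
      (measurable_fun_sum h2 (measurable_const (a := (0 : ℝ≥0∞))))
      (measurable_fun_sum (measurable_const (a := (0 : ℝ≥0∞)))
        (measurable_const (a := (0 : ℝ≥0∞))))
  have h4 := h3.comp (MeasurableEquiv.sumProdSum S Unit A Unit).measurable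
  rwa [Function.comp_assoc, MeasurableEquiv.symm_comp_self] at h4

theorem measurable_jumpMeasure_right (M : CTMDP S A) (x : S ⊕ Unit) :
    Measurable fun a => M.jumpMeasure x a :=
  M.measurable_jumpMeasure.comp measurable_prodMk_left

/-- The intensity `Λ^k(dy | h_k, u) = ∫ π(da | h_k, T_k + u) q(dy \ {x_k} | x_k, a)` at the time
`u` after the `k`-th jump. A predictable `π` depends, between the jumps `k` and `k + 1`, only on the
history `h_k` and the time, so it is evaluated at the path that makes no jump after the `k`-th. -/
def intensity {M : CTMDP S A} (π : M.Policy) (k : ℕ) (ω : Path S) (u : ℝ) : Measure S :=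
  (π.toFun (freeze k ω) ((jumpTime k ω).toNNReal + u.toNNReal)).bind
    fun a => M.jumpMeasure (mark k ω) a

/-- The tail `exp (-∫₀ᵘ Λ^k(S | h_k, v) dv)`. -/
def survival {M : CTMDP S A} (π : M.Policy) (k : ℕ) (ω : Path S) (u : ℝ) : ℝ≥0∞ :=
  EReal.exp (-((∫⁻ v in Set.Ioc 0 u, intensity π k ω v Set.univ : ℝ≥0∞) : EReal))

/-- The probability `exp (-∫₀^∞ Λ^k(S | h_k, v) dv)` that there is no jump after the `k`-th. -/
def noJump {M : CTMDP S A} (π : M.Policy) (k : ℕ) (ω : Path S) : ℝ≥0∞ :=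
  EReal.exp (-((∫⁻ v in Set.Ioi 0, intensity π k ω v Set.univ : ℝ≥0∞) : EReal))

open Classical in
/-- The conditional law of `(θ_{k+1}, x_{k+1})` given `h_k`: the point mass at `(∞, x_∞)` if
`θ_k = ∞`, and otherwise `Λ^k(dy | h_k, u) exp (-∫₀ᵘ Λ^k(S | h_k, v) dv) du` on `(0, ∞) × S` together
with the mass `exp (-∫₀^∞ Λ^k(S | h_k, v) dv)` at `(∞, x_∞)`. -/
def stepMeasure {M : CTMDP S A} (π : M.Policy) (k : ℕ) (ω : Path S) :
    Measure (ℝ≥0∞ × (S ⊕ Unit)) :=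
  if sojourn k ω = ⊤ then Measure.dirac (⊤, Sum.inr ())
  else
    (volume.restrict (Set.Ioi (0 : ℝ))).bind (fun u =>
        (survival π k ω u • intensity π k ω u).map fun y => (ENNReal.ofReal u, Sum.inl y)) +
      noJump π k ω • Measure.dirac (⊤, Sum.inr ())

theorem measurable_intensity {M : CTMDP S A} (π : M.Policy) (k : ℕ) :
    Measurable fun p : Path S × ℝ => intensity π k p.1 p.2 := by
  have hπ : Measurable fun p : Path S × ℝ =>
      π.toFun (freeze k p.1) ((jumpTime k p.1).toNNReal + p.2.toNNReal) :=
    π.measurable.comp (((measurable_freeze k).comp measurable_fst).prodMk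
      (((measurable_jumpTime k).comp measurable_fst).ennreal_toNNReal.add
        measurable_snd.real_toNNReal))
  let κ : Kernel (Path S × ℝ) (A ⊕ Unit) := ⟨_, hπ⟩
  have : IsMarkovKernel κ := ⟨fun p => π.isProbabilityMeasure _ _⟩
  have hJ : Measurable fun z : (Path S × ℝ) × (A ⊕ Unit) => M.jumpMeasure (mark k z.1.1) z.2 :=
    M.measurable_jumpMeasure.comp
      (((measurable_mark k).comp measurable_fst.fst).prodMk measurable_snd)
  refine Measure.measurable_of_measurable_coe _ fun Γ hΓ => ?_
  have h : ∀ p : Path S × ℝ, intensity π k p.1 p.2 Γ =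
      ∫⁻ a, M.jumpMeasure (mark k p.1) a Γ ∂κ p := fun p =>
    Measure.bind_apply hΓ (M.measurable_jumpMeasure_right _).aemeasurable
  simp_rw [h]
  exact Measurable.lintegral_kernel_prod_right
    (f := fun (p : Path S × ℝ) a => M.jumpMeasure (mark k p.1) a Γ) ((Measure.measurable_coe hΓ).comp hJ)

theorem intensity_univ_le {M : CTMDP S A} (π : M.Policy) (k : ℕ) (ω : Path S) {x : S}
    (hx : mark k ω = Sum.inl x) (u : ℝ) : intensity π k ω u Set.univ ≤ M.maxRate x := by
  have := π.isProbabilityMeasure (freeze k ω) ((jumpTime k ω).toNNReal + u.toNNReal)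
  rw [intensity, Measure.bind_apply MeasurableSet.univ
    (M.measurable_jumpMeasure_right _).aemeasurable, hx]
  exact (lintegral_mono fun a => M.jumpMeasure_univ_le x a).trans (by simp)

theorem isFiniteMeasure_intensity {M : CTMDP S A} (π : M.Policy) (k : ℕ) (ω : Path S) (u : ℝ) :
    IsFiniteMeasure (intensity π k ω u) := by
  rcases hx : mark k ω with x | x
  · exact ⟨(intensity_univ_le π k ω hx u).trans_lt (M.q_stable x)⟩
  · refine ⟨?_⟩
    rw [intensity, Measure.bind_apply MeasurableSet.univ
      (M.measurable_jumpMeasure_right _).aemeasurable, hx]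
    simp [jumpMeasure]

theorem measurable_intensity_univ {M : CTMDP S A} (π : M.Policy) (k : ℕ) :
    Measurable fun p : Path S × ℝ => intensity π k p.1 p.2 Set.univ :=
  (Measure.measurable_coe MeasurableSet.univ).comp (measurable_intensity π k)

theorem measurable_intensity_univ_right {M : CTMDP S A} (π : M.Policy) (k : ℕ) (ω : Path S) :
    Measurable fun u : ℝ => intensity π k ω u Set.univ :=
  Measurable.comp (g := fun p : Path S × ℝ => intensity π k p.1 p.2 Set.univ)
    (f := fun u : ℝ => (ω, u)) (measurable_intensity_univ π k) measurable_prodMk_left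

theorem measurable_exp_neg {α : Type*} [MeasurableSpace α] {f : α → ℝ≥0∞} (hf : Measurable f) :
    Measurable fun a => EReal.exp (-(f a : EReal)) :=
  EReal.exp_monotone.measurable.comp hf.coe_ereal_ennreal.neg

theorem measurable_survival {M : CTMDP S A} (π : M.Policy) (k : ℕ) :
    Measurable fun p : Path S × ℝ => survival π k p.1 p.2 := by
  refine measurable_exp_neg (f := fun p : Path S × ℝ =>
    ∫⁻ v in Set.Ioc 0 p.2, intensity π k p.1 v Set.univ) ?_
  let T : Set ((Path S × ℝ) × ℝ) := {z | 0 < z.2 ∧ z.2 ≤ z.1.2}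
  have hT : MeasurableSet T := (measurableSet_lt measurable_const measurable_snd).inter
    (measurableSet_le measurable_snd measurable_fst.snd)
  have hG : Measurable fun z : (Path S × ℝ) × ℝ => intensity π k z.1.1 z.2 Set.univ :=
    Measurable.comp (g := fun p : Path S × ℝ => intensity π k p.1 p.2 Set.univ)
      (f := fun z : (Path S × ℝ) × ℝ => (z.1.1, z.2)) (measurable_intensity_univ π k) (by fun_prop)
  have h := (hG.indicator hT).lintegral_prod_right' (ν := volume)
  have e : ∀ p : Path S × ℝ, ∫⁻ v in Set.Ioc 0 p.2, intensity π k p.1 v Set.univ =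
      ∫⁻ v, T.indicator (fun z => intensity π k z.1.1 z.2 Set.univ) (p, v) := fun p => by
    rw [← lintegral_indicator measurableSet_Ioc]
    refine lintegral_congr fun v => ?_
    by_cases hv : 0 < v ∧ v ≤ p.2
    · rw [Set.indicator_of_mem (s := Set.Ioc 0 p.2) hv, Set.indicator_of_mem (s := T) hv]
    · rw [Set.indicator_of_notMem (s := Set.Ioc 0 p.2) hv, Set.indicator_of_notMem (s := T) hv]
  simp_rw [e]
  exact h

theorem measurable_noJump {M : CTMDP S A} (π : M.Policy) (k : ℕ) :
    Measurable fun ω : Path S => noJump π k ω :=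
  measurable_exp_neg (measurable_intensity_univ π k).lintegral_prod_right'

theorem measurable_map_smul {α : Type*} [MeasurableSpace α] {κ : α × ℝ → Measure S}
    (hκ : Measurable κ) (hfin : ∀ p, IsFiniteMeasure (κ p)) {s : α × ℝ → ℝ≥0∞}
    (hs : Measurable s) :
    Measurable fun p : α × ℝ => (s p • κ p).map
      fun y => (ENNReal.ofReal p.2, (Sum.inl y : S ⊕ Unit)) := by
  refine Measure.measurable_of_measurable_coe _ fun D hD => ?_
  have hmk : ∀ u : ℝ, Measurable fun y : S => (ENNReal.ofReal u, (Sum.inl y : S ⊕ Unit)) :=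
    fun u => measurable_const.prodMk measurable_inl
  simp_rw [Measure.map_apply (hmk _) hD, Measure.smul_apply, smul_eq_mul]
  refine hs.mul ?_
  have hE : MeasurableSet ((fun z : (α × ℝ) × S =>
      (ENNReal.ofReal z.1.2, (Sum.inl z.2 : S ⊕ Unit))) ⁻¹' D) :=
    measurableSet_preimage (by fun_prop) hD
  exact Kernel.measurable_kernel_prodMk_left_of_finite (κ := ⟨κ, hκ⟩) hE hfin

theorem measurable_density {M : CTMDP S A} (π : M.Policy) (k : ℕ) :
    Measurable fun p : Path S × ℝ => (survival π k p.1 p.2 • intensity π k p.1 p.2).map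
      fun y => (ENNReal.ofReal p.2, (Sum.inl y : S ⊕ Unit)) :=
  measurable_map_smul (measurable_intensity π k)
    (fun p => isFiniteMeasure_intensity π k p.1 p.2) (measurable_survival π k)

theorem measurable_density_right {M : CTMDP S A} (π : M.Policy) (k : ℕ) (ω : Path S) :
    Measurable fun u : ℝ => (survival π k ω u • intensity π k ω u).map
      fun y => (ENNReal.ofReal u, (Sum.inl y : S ⊕ Unit)) :=
  (measurable_density π k).comp measurable_prodMk_left

theorem measurable_stepMeasure {M : CTMDP S A} (π : M.Policy) (k : ℕ) :
    Measurable (stepMeasure π k) := by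
  refine Measurable.ite (measurable_sojourn k (measurableSet_singleton ⊤)) measurable_const ?_
  refine Measure.measurable_of_measurable_coe _ fun D hD => ?_
  have h1 : ∀ ω : Path S, ((volume.restrict (Set.Ioi (0 : ℝ))).bind (fun u =>
      (survival π k ω u • intensity π k ω u).map fun y =>
        (ENNReal.ofReal u, (Sum.inl y : S ⊕ Unit)))) D = ∫⁻ u in Set.Ioi (0 : ℝ),
      ((survival π k ω u • intensity π k ω u).map fun y =>
        (ENNReal.ofReal u, (Sum.inl y : S ⊕ Unit))) D := fun ω =>
    Measure.bind_apply hD (measurable_density_right π k ω).aemeasurable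
  simp_rw [Measure.add_apply, h1, Measure.smul_apply, smul_eq_mul]
  exact ((Measure.measurable_coe hD).comp (measurable_density π k)).lintegral_prod_right'.add
    ((measurable_noJump π k).mul_const _)

theorem mark_eq_inl {k : ℕ} {ω : Path S} (h : sojourn k ω ≠ ⊤) : ∃ x, mark k ω = Sum.inl x := by
  rcases k with _ | k
  · obtain ⟨x, hx⟩ := ω.2.2.1
    exact ⟨x, hx.symm⟩
  · rcases hm : mark (k + 1) ω with x | x
    · exact ⟨x, rfl⟩
    · exact absurd ((ω.2.2.2 k).2.1.2 hm) h

theorem isProbabilityMeasure_stepMeasure {M : CTMDP S A} (π : M.Policy) (k : ℕ) (ω : Path S) :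
    IsProbabilityMeasure (stepMeasure π k ω) := by
  by_cases h : sojourn k ω = ⊤
  · rw [stepMeasure, if_pos h]
    infer_instance
  · obtain ⟨x, hx⟩ := mark_eq_inl h
    have hmk : ∀ u : ℝ, Measurable fun y : S => (ENNReal.ofReal u, (Sum.inl y : S ⊕ Unit)) :=
      fun u => measurable_const.prodMk measurable_inl
    refine ⟨?_⟩
    rw [stepMeasure, if_neg h, Measure.add_apply, Measure.bind_apply MeasurableSet.univ
      (measurable_density_right π k ω).aemeasurable]
    simp_rw [Measure.map_apply (hmk _) MeasurableSet.univ]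
    simp only [Set.preimage_univ, Measure.smul_apply, smul_eq_mul, measure_univ, mul_one]
    exact lintegral_exp_neg_add_exp_neg (fun u => intensity π k ω u Set.univ)
      (measurable_intensity_univ_right π k ω) (M.maxRate x) (M.q_stable x)
      fun u => intensity_univ_le π k ω hx u

end Intensity

/-! ### The law of the controlled process -/

/-- The sequence that extends a history `(θ₀, x₀), …, (θ_k, x_k)` by the entries `(∞, x_∞)`. -/
def extendHist (k : ℕ) (h : (i : Finset.Iic k) → ℝ≥0∞ × (S ⊕ Unit)) : ℕ → ℝ≥0∞ × (S ⊕ Unit) :=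
  fun i => if hi : i ≤ k then h ⟨i, Finset.mem_Iic.2 hi⟩ else (⊤, Sum.inr ())

theorem measurable_extendHist (k : ℕ) :
    Measurable (extendHist k : ((i : Finset.Iic k) → ℝ≥0∞ × (S ⊕ Unit)) → _) := by
  refine measurable_pi_lambda _ fun i => ?_
  by_cases hi : i ≤ k
  · simp only [extendHist, hi, dif_pos]
    exact measurable_pi_apply _
  · simp only [extendHist, hi]
    exact measurable_const

variable [StandardBorelSpace S]

open Classical in
/-- The transition kernel from the history `h_k` to `(θ_{k+1}, x_{k+1})`; histories that do not
belong to a sample path are irrelevant. -/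
def stepKernel {M : CTMDP S A} (π : M.Policy) (k : ℕ) :
    Kernel ((i : Finset.Iic k) → ℝ≥0∞ × (S ⊕ Unit)) (ℝ≥0∞ × (S ⊕ Unit)) where
  toFun h := if hp : IsPath (extendHist k h) then stepMeasure π k ⟨extendHist k h, hp⟩
    else Measure.dirac (⊤, Sum.inr ())
  measurable' := by
    refine Measurable.dite (s := {h | IsPath (extendHist k h)})
      (f := fun h => stepMeasure π k ⟨extendHist k h.1, h.2⟩)
      (g := fun _ => Measure.dirac (⊤, Sum.inr ())) ?_ measurable_const
      (measurable_extendHist k measurableSet_isPath)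
    exact (measurable_stepMeasure π k).comp
      (((measurable_extendHist k).comp measurable_subtype_coe).subtype_mk)

instance {M : CTMDP S A} (π : M.Policy) (k : ℕ) : IsMarkovKernel (stepKernel π k) := by
  refine ⟨fun h => ?_⟩
  by_cases hp : IsPath (extendHist k h)
  · simpa [stepKernel, hp] using isProbabilityMeasure_stepMeasure π k ⟨extendHist k h, hp⟩
  · simp only [stepKernel, Kernel.coe_mk, hp, dif_neg, not_false_eq_true]
    infer_instance

/-- The measure `P_γ^π`: the law of `(θ₀, x₀), (θ₁, x₁), …` on the sample space when `x₀` has the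
law `γ` and the conditional law of `(θ_{k+1}, x_{k+1})` given `h_k` is the step measure. -/
def law {M : CTMDP S A} (π : M.Policy) (γ : Measure S) : Measure (Path S) :=
  (Kernel.trajMeasure (X := fun _ => ℝ≥0∞ × (S ⊕ Unit))
    (γ.map fun x => ((0 : ℝ≥0∞), (Sum.inl x : S ⊕ Unit))) (stepKernel π)).comap Subtype.val

theorem ae_stepMeasure {M : CTMDP S A} (π : M.Policy) (k : ℕ) (ω : Path S) :
    ∀ᵐ e ∂stepMeasure π k ω, 0 < e.1 ∧ (e.1 = ⊤ ↔ e.2 = Sum.inr ()) ∧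
      (sojourn k ω = ⊤ → e.1 = ⊤) := by
  have hinr : MeasurableSet ({Sum.inr ()} : Set (S ⊕ Unit)) := by
    simpa using (measurableSet_inr_image (α := S)).2 (measurableSet_singleton ())
  have htop : MeasurableSet {e : ℝ≥0∞ × (S ⊕ Unit) | e.1 = ⊤} :=
    measurable_fst (measurableSet_singleton ⊤)
  have hD : MeasurableSet {e : ℝ≥0∞ × (S ⊕ Unit) | 0 < e.1 ∧ (e.1 = ⊤ ↔ e.2 = Sum.inr ()) ∧
      (sojourn k ω = ⊤ → e.1 = ⊤)} :=
    MeasurableSet.inter (measurable_fst measurableSet_Ioi)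
      (MeasurableSet.inter (htop.iff (measurable_snd hinr)) ((MeasurableSet.const _).imp htop))
  by_cases h : sojourn k ω = ⊤
  · rw [stepMeasure, if_pos h, ae_dirac_iff hD]
    simp
  · change stepMeasure π k ω {e | 0 < e.1 ∧ (e.1 = ⊤ ↔ e.2 = Sum.inr ()) ∧
      (sojourn k ω = ⊤ → e.1 = ⊤)}ᶜ = 0
    rw [stepMeasure, if_neg h, Measure.add_apply, Measure.bind_apply hD.compl
      (measurable_density_right π k ω).aemeasurable, Measure.smul_apply,
      Measure.dirac_apply' _ hD.compl]
    have h0 : ∀ u ∈ Set.Ioi (0 : ℝ), ((survival π k ω u • intensity π k ω u).map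
        fun y => (ENNReal.ofReal u, (Sum.inl y : S ⊕ Unit)))
        {e | 0 < e.1 ∧ (e.1 = ⊤ ↔ e.2 = Sum.inr ()) ∧ (sojourn k ω = ⊤ → e.1 = ⊤)}ᶜ = 0 := by
      intro u hu
      rw [Measure.map_apply (measurable_const.prodMk measurable_inl) hD.compl]
      refine measure_mono_null (t := ∅) (fun y hy => ?_) measure_empty
      simp [h, Set.mem_Ioi.1 hu] at hy
    rw [setLIntegral_congr_fun measurableSet_Ioi h0]
    simp [h]

theorem extendHist_frestrictLe (k : ℕ) (ω : Path S) :
    extendHist k (Preorder.frestrictLe k ω.1) = (freeze k ω).1 := by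
  funext i
  by_cases hi : i ≤ k <;> simp [extendHist, freeze, hi]

theorem freeze_freeze (k : ℕ) (ω : Path S) : freeze k (freeze k ω) = freeze k ω := by
  refine Subtype.ext (funext fun i => ?_)
  by_cases hi : i ≤ k <;> simp [freeze, hi]

theorem stepMeasure_freeze {M : CTMDP S A} (π : M.Policy) (k : ℕ) (ω : Path S) :
    stepMeasure π k (freeze k ω) = stepMeasure π k ω := by
  have h1 : ∀ i ≤ k, sojourn i (freeze k ω) = sojourn i ω := fun i hi => by
    simp [sojourn, freeze, hi]
  have h2 : mark k (freeze k ω) = mark k ω := by simp [mark, freeze]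
  have h3 : jumpTime k (freeze k ω) = jumpTime k ω :=
    Finset.sum_congr rfl fun i hi => h1 i (by simpa [Nat.lt_succ_iff] using hi)
  have h4 : intensity π k (freeze k ω) = intensity π k ω := by
    funext u
    rw [intensity, intensity, freeze_freeze, h2, h3]
  simp only [stepMeasure, survival, noJump, h1 k le_rfl, h4]

theorem stepKernel_frestrictLe {M : CTMDP S A} (π : M.Policy) (k : ℕ) (ω : Path S) :
    stepKernel π k (Preorder.frestrictLe k ω.1) = stepMeasure π k ω := by
  have hp : IsPath (extendHist k (Preorder.frestrictLe k ω.1)) :=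
    extendHist_frestrictLe k ω ▸ (freeze k ω).2
  have : (⟨_, hp⟩ : Path S) = freeze k ω := Subtype.ext (extendHist_frestrictLe k ω)
  rw [← stepMeasure_freeze, ← this]
  exact dif_pos hp

theorem isPath_of_forall {ω : ℕ → ℝ≥0∞ × (S ⊕ Unit)}
    (h0 : (ω 0).1 = 0 ∧ (ω 0).2 ∈ Set.range Sum.inl)
    (h : ∀ k, IsPath (extendHist k (Preorder.frestrictLe k ω)) →
      0 < (ω (k + 1)).1 ∧ ((ω (k + 1)).1 = ⊤ ↔ (ω (k + 1)).2 = Sum.inr ()) ∧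
        ((ω k).1 = ⊤ → (ω (k + 1)).1 = ⊤)) : IsPath ω := by
  have key : ∀ k, IsPath (extendHist k (Preorder.frestrictLe k ω)) := by
    intro k
    have hle : ∀ (j i : ℕ), i ≤ j → extendHist j (Preorder.frestrictLe j ω) i = ω i :=
      fun j i hi => by simp [extendHist, hi]
    have hgt : ∀ (j i : ℕ), ¬i ≤ j →
        extendHist j (Preorder.frestrictLe j ω) i = (⊤, Sum.inr ()) :=
      fun j i hi => by simp [extendHist, hi]
    induction k with
    | zero =>
      refine ⟨by rw [hle 0 0 le_rfl]; exact h0.1, by rw [hle 0 0 le_rfl]; exact h0.2, fun m => ?_⟩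
      rw [hgt 0 (m + 1) (by omega)]
      simp
    | succ k ih =>
      refine ⟨by rw [hle _ 0 (by omega)]; exact h0.1, by rw [hle _ 0 (by omega)]; exact h0.2,
        fun m => ?_⟩
      by_cases hm : m + 1 ≤ k
      · have := ih.2.2 m
        rw [hle k (m + 1) hm, hle k m (by omega)] at this
        rwa [hle _ (m + 1) (by omega), hle _ m (by omega)]
      · by_cases hm' : m = k
        · subst hm'
          rw [hle _ (m + 1) le_rfl, hle _ m (by omega)]
          exact h m ih
        · rw [hgt _ (m + 1) (by omega)]
          simp
  exact ⟨h0.1, h0.2, fun m => h m (key m)⟩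

theorem trajMeasure_map_zero {M : CTMDP S A} (π : M.Policy) (γ : Measure S)
    [IsProbabilityMeasure γ] :
    (Kernel.trajMeasure (X := fun _ => ℝ≥0∞ × (S ⊕ Unit))
      (γ.map fun x => ((0 : ℝ≥0∞), (Sum.inl x : S ⊕ Unit))) (stepKernel π)).map (fun ω => ω 0) =
      γ.map fun x => ((0 : ℝ≥0∞), (Sum.inl x : S ⊕ Unit)) := by
  have h : (fun ω : ℕ → ℝ≥0∞ × (S ⊕ Unit) => ω 0) =
      (fun h : (i : Finset.Iic 0) → ℝ≥0∞ × (S ⊕ Unit) => h ⟨0, by simp⟩) ∘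
        Preorder.frestrictLe (π := fun _ => ℝ≥0∞ × (S ⊕ Unit)) 0 := rfl
  rw [h, ← Measure.map_map (by fun_prop) (by fun_prop), Kernel.trajMeasure,
    Measure.map_comp _ _ (by fun_prop), Kernel.traj_map_frestrictLe, Kernel.partialTraj_self,
    Measure.id_comp, Measure.map_map (by fun_prop) (by fun_prop)]
  exact Measure.map_id

theorem ae_isPath {M : CTMDP S A} (π : M.Policy) (γ : Measure S) [IsProbabilityMeasure γ] :
    ∀ᵐ ω ∂Kernel.trajMeasure (X := fun _ => ℝ≥0∞ × (S ⊕ Unit))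
      (γ.map fun x => ((0 : ℝ≥0∞), (Sum.inl x : S ⊕ Unit))) (stepKernel π), IsPath ω := by
  have hm0 : Measurable fun x : S => ((0 : ℝ≥0∞), (Sum.inl x : S ⊕ Unit)) :=
    measurable_const.prodMk measurable_inl
  have : IsProbabilityMeasure (γ.map fun x => ((0 : ℝ≥0∞), (Sum.inl x : S ⊕ Unit))) :=
    Measure.isProbabilityMeasure_map hm0.aemeasurable
  set μ := Kernel.trajMeasure (X := fun _ => ℝ≥0∞ × (S ⊕ Unit))
      (γ.map fun x => ((0 : ℝ≥0∞), (Sum.inl x : S ⊕ Unit))) (stepKernel π) with hμ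
  have h0 : ∀ᵐ ω ∂μ, (ω 0).1 = 0 ∧ (ω 0).2 ∈ Set.range Sum.inl := by
    have hD : MeasurableSet {e : ℝ≥0∞ × (S ⊕ Unit) | e.1 = 0 ∧ e.2 ∈ Set.range Sum.inl} :=
      MeasurableSet.inter (measurable_fst (measurableSet_singleton 0))
        (measurable_snd measurableSet_range_inl)
    have h1 : ∀ᵐ e ∂μ.map (fun ω => ω 0), e.1 = 0 ∧ e.2 ∈ Set.range Sum.inl := by
      rw [hμ, trajMeasure_map_zero, ae_map_iff hm0.aemeasurable hD]
      exact ae_of_all _ fun x => ⟨rfl, x, rfl⟩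
    exact (ae_map_iff (measurable_pi_apply 0).aemeasurable hD).1 h1
  have hk : ∀ k, ∀ᵐ ω ∂μ, IsPath (extendHist k (Preorder.frestrictLe k ω)) →
      0 < (ω (k + 1)).1 ∧ ((ω (k + 1)).1 = ⊤ ↔ (ω (k + 1)).2 = Sum.inr ()) ∧
        ((ω k).1 = ⊤ → (ω (k + 1)).1 = ⊤) := by
    intro k
    let p : ((i : Finset.Iic k) → ℝ≥0∞ × (S ⊕ Unit)) × (ℝ≥0∞ × (S ⊕ Unit)) → Prop := fun z =>
      IsPath (extendHist k z.1) → 0 < z.2.1 ∧ (z.2.1 = ⊤ ↔ z.2.2 = Sum.inr ()) ∧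
        ((z.1 ⟨k, by simp⟩).1 = ⊤ → z.2.1 = ⊤)
    have hinr : MeasurableSet ({Sum.inr ()} : Set (S ⊕ Unit)) := by
      simpa using (measurableSet_inr_image (α := S)).2 (measurableSet_singleton ())
    have hp : MeasurableSet {z | p z} := by
      refine MeasurableSet.imp (p := fun z : ((i : Finset.Iic k) → ℝ≥0∞ × (S ⊕ Unit)) ×
        (ℝ≥0∞ × (S ⊕ Unit)) => IsPath (extendHist k z.1))
        (measurableSet_preimage ((measurable_extendHist k).comp measurable_fst)
          measurableSet_isPath) ?_
      have htop : MeasurableSet {z : ((i : Finset.Iic k) → ℝ≥0∞ × (S ⊕ Unit)) ×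
          (ℝ≥0∞ × (S ⊕ Unit)) | z.2.1 = ⊤} :=
        measurable_snd.fst (measurableSet_singleton ⊤)
      refine MeasurableSet.inter (measurable_snd.fst measurableSet_Ioi) (MeasurableSet.inter
        (htop.iff (measurable_snd.snd hinr)) (MeasurableSet.imp ?_ htop))
      exact ((measurable_pi_apply _).comp measurable_fst).fst (measurableSet_singleton ⊤)
    have h1 : ∀ᵐ z ∂(μ.map (Preorder.frestrictLe k)) ⊗ₘ (stepKernel π k), p z := by
      refine Measure.ae_compProd_of_ae_ae hp (ae_of_all _ fun h => ?_)
      by_cases hh : IsPath (extendHist k h)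
      · have e : stepKernel π k h = stepMeasure π k ⟨_, hh⟩ := dif_pos hh
        rw [e]
        filter_upwards [ae_stepMeasure π k ⟨_, hh⟩] with z hz _
        simpa [sojourn, extendHist] using hz
      · exact ae_of_all _ fun z h' => absurd h' hh
    rw [hμ, Kernel.map_frestrictLe_trajMeasure_compProd_eq_map_trajMeasure, ae_map_iff] at h1
    · exact h1
    · exact Measurable.aemeasurable (by fun_prop)
    · exact hp
  filter_upwards [h0, ae_all_iff.2 hk] with ω hω0 hω
  exact isPath_of_forall hω0 hω

theorem law_map_val {M : CTMDP S A} (π : M.Policy) (γ : Measure S) [IsProbabilityMeasure γ] :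
    (law π γ).map Subtype.val = Kernel.trajMeasure (X := fun _ => ℝ≥0∞ × (S ⊕ Unit))
      (γ.map fun x => ((0 : ℝ≥0∞), (Sum.inl x : S ⊕ Unit))) (stepKernel π) := by
  refine ((MeasurableEmbedding.subtype_coe measurableSet_isPath).map_comap _).trans ?_
  rw [Subtype.range_coe]
  exact Measure.restrict_eq_self_of_ae_mem (ae_isPath π γ)

instance {M : CTMDP S A} (π : M.Policy) (γ : Measure S) [IsProbabilityMeasure γ] :
    IsProbabilityMeasure (law π γ) := by
  have : IsProbabilityMeasure (γ.map fun x => ((0 : ℝ≥0∞), (Sum.inl x : S ⊕ Unit))) :=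
    Measure.isProbabilityMeasure_map (measurable_const.prodMk measurable_inl).aemeasurable
  refine ⟨?_⟩
  rw [← Set.preimage_univ (f := Subtype.val),
    ← Measure.map_apply measurable_subtype_coe MeasurableSet.univ, law_map_val]
  exact measure_univ

/-- Under `P_γ^π` the initial state has the law `γ`. -/
theorem law_map_mark_zero {M : CTMDP S A} (π : M.Policy) (γ : Measure S)
    [IsProbabilityMeasure γ] : (law π γ).map (mark 0) = γ.map Sum.inl := by
  have h : (mark 0 : Path S → S ⊕ Unit) =
      Prod.snd ∘ (fun ω : ℕ → ℝ≥0∞ × (S ⊕ Unit) => ω 0) ∘ Subtype.val := rfl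
  rw [h, ← Measure.map_map measurable_snd ((measurable_pi_apply 0).comp measurable_subtype_coe),
    ← Measure.map_map (measurable_pi_apply 0) measurable_subtype_coe, law_map_val,
    trajMeasure_map_zero, Measure.map_map measurable_snd (measurable_const.prodMk measurable_inl)]
  rfl

/-- Under `P_γ^π` the conditional law of `(θ_{k+1}, x_{k+1})` given `h_k` is the step measure. -/
theorem law_step {M : CTMDP S A} (π : M.Policy) (γ : Measure S) [IsProbabilityMeasure γ] (k : ℕ)
    {B : Set (Path S)} (hB : MeasurableSet B) {D : Set (ℝ≥0∞ × (S ⊕ Unit))}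
    (hD : MeasurableSet D) :
    law π γ {ω | freeze k ω ∈ B ∧ ω.1 (k + 1) ∈ D} =
      ∫⁻ ω in freeze k ⁻¹' B, stepMeasure π k ω D ∂law π γ := by
  have : IsProbabilityMeasure (γ.map fun x => ((0 : ℝ≥0∞), (Sum.inl x : S ⊕ Unit))) :=
    Measure.isProbabilityMeasure_map (measurable_const.prodMk measurable_inl).aemeasurable
  let f : (ℕ → ℝ≥0∞ × (S ⊕ Unit)) → ((i : Finset.Iic k) → ℝ≥0∞ × (S ⊕ Unit)) :=
    Preorder.frestrictLe k
  have hf : Measurable f := by fun_prop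
  let B' : Set ((i : Finset.Iic k) → ℝ≥0∞ × (S ⊕ Unit)) := extendHist k ⁻¹' (Subtype.val '' B)
  have hB' : MeasurableSet B' := measurable_extendHist k
    ((MeasurableEmbedding.subtype_coe measurableSet_isPath).measurableSet_image.2 hB)
  have hmem : ∀ ω : Path S, f ω.1 ∈ B' ↔ freeze k ω ∈ B := fun ω => by
    change extendHist k (Preorder.frestrictLe k ω.1) ∈ Subtype.val '' B ↔ _
    rw [extendHist_frestrictLe]
    exact Subtype.val_injective.mem_set_image
  have h1 : {ω : Path S | freeze k ω ∈ B ∧ ω.1 (k + 1) ∈ D} =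
      Subtype.val ⁻¹' ((fun x : ℕ → ℝ≥0∞ × (S ⊕ Unit) => (f x, x (k + 1))) ⁻¹' (B' ×ˢ D)) := by
    ext ω
    exact and_congr_left' (hmem ω).symm
  have h2 : freeze k ⁻¹' B = Subtype.val ⁻¹' (f ⁻¹' B') := by
    ext ω
    exact (hmem ω).symm
  have hpair : Measurable fun x : ℕ → ℝ≥0∞ × (S ⊕ Unit) => (f x, x (k + 1)) := by fun_prop
  have hκ : Measurable fun h => stepKernel π k h D := (stepKernel π k).measurable_coe hD
  simp_rw [← stepKernel_frestrictLe]
  rw [h1, ← Measure.map_apply measurable_subtype_coe (hpair (hB'.prod hD)), h2,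
    ← setLIntegral_map (f := fun x => stepKernel π k (f x) D) (hf hB') (hκ.comp hf)
      measurable_subtype_coe, law_map_val, ← Measure.map_apply hpair (hB'.prod hD),
    ← setLIntegral_map (f := fun h => stepKernel π k h D) hB' hκ hf,
    ← Measure.compProd_apply_prod hB' hD,
    Kernel.map_frestrictLe_trajMeasure_compProd_eq_map_trajMeasure]

/-! ### Conditions and the performance functional -/

/-- The Lyapunov-type condition. -/
structure LyapunovCondition (M : CTMDP S A) (w : S → ℝ) (ρ b : ℝ) (Sl : ℕ → Set S) : Prop where
  measurable_w : Measurable w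
  one_le_w : ∀ x, 1 ≤ w x
  rho_nonneg : 0 ≤ ρ
  b_nonneg : 0 ≤ b
  measurableSet_Sl : ∀ l, MeasurableSet (Sl l)
  monotone_Sl : Monotone Sl
  iUnion_Sl : ⋃ l, Sl l = Set.univ
  tendsto_iInf : Tendsto (fun l => ⨅ x ∈ (Sl l)ᶜ, (w x : EReal)) atTop (𝓝 ⊤)
  /-- `∫ w dq(· | x, a)` exists and is at most `ρ w(x) + b` -/
  drift : ∀ x, ∀ a ∈ M.adm x, Integrable w (M.q x a).totalVariation ∧
    ∫ y, w y ∂(M.q x a).toJordanDecomposition.posPart -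
      ∫ y, w y ∂(M.q x a).toJordanDecomposition.negPart ≤ ρ * w x + b
  rates_bounded : ∀ l, (⨆ x ∈ Sl l, M.maxRate x) < ⊤

/-- The condition under which the performance functional is bounded from below. -/
structure CostCondition (M : CTMDP S A) (w : S → ℝ) (ρ α : ℝ) (γ : Measure S) (C c : ℝ) :
    Prop where
  integrable_w : Integrable w γ
  rho_lt : ρ < α
  C_nonneg : 0 ≤ C
  c_nonneg : 0 ≤ c
  abs_iInf_cost_le : ∀ x, (⨅ a ∈ M.adm x, (M.cost x a : EReal)).abs ≤
    ENNReal.ofReal (C * w x + c)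

/-- The integral `∫ f⁺ - ∫ f⁻` of an extended real function, with the convention `∞ - ∞ = -∞`. -/
def eintegral {X : Type*} [MeasurableSpace X] (μ : Measure X) (f : X → EReal) : EReal :=
  ((∫⁻ x, (f x).toENNReal ∂μ : ℝ≥0∞) : EReal) - ((∫⁻ x, (-f x).toENNReal ∂μ : ℝ≥0∞) : EReal)

/-- The expected cost rate `∫_A c₀(ξ_{t-}, a) π(da | ω, t)`; it is zero at `x_∞`. -/
def costRate {M : CTMDP S A} (π : M.Policy) (ω : Path S) (t : ℝ≥0) : EReal :=
  match leftState t ω with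
  | Sum.inl x => eintegral ((π.toFun ω t).comap Sum.inl) fun a => (M.cost x a : EReal)
  | Sum.inr _ => 0

/-- The expected total `α`-discounted cost `V₀(π)` under the initial distribution `γ`. -/
def discountedCost {M : CTMDP S A} (π : M.Policy) (γ : Measure S) (α : ℝ) : EReal :=
  eintegral (law π γ) fun ω =>
    eintegral (volume.restrict (Set.Ioi (0 : ℝ))) fun t =>
      (Real.exp (-α * t) : EReal) * costRate π ω t.toNNReal

end CTMDP

end

/-!
Write `W_s(v)` for `growthBound ρ b s v`, the solution at time `s` of `W' = ρ W + b`, `W_0 = v`.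
By the drift condition, integrating by parts against the exponential survival function of a
sojourn shows that `W_{t - T_n}(w(x_n))`, frozen at the value `w(ξ_t)` once `T_n > t`, is a
supermartingale in `n`.

A visit to a set of bounded jump rates is followed by a sojourn longer than one with probability
bounded below, and only finitely many such sojourns can start before time `t`; hence almost surely
only finitely many jumps before `t` land in such a set. If explosion occurred before `t`, the
exhaustion would therefore force `w(x_n) → ∞`, against the supermartingale bound. Fatou's lemma
gives the growth estimate, and Tonelli's theorem turns it into the bound on the discounted cost.
-/

namespace CTMDP

section ExponentialSurvival

theorem setLIntegral_ofReal_eq_ofReal_intervalIntegral {f : ℝ → ℝ} {a b : ℝ} (hab : a ≤ b)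
    (hf : IntervalIntegrable f volume a b) (h0 : ∀ u ∈ Set.Ioc a b, 0 ≤ f u) :
    ∫⁻ u in Set.Ioc a b, ENNReal.ofReal (f u) = ENNReal.ofReal (∫ u in a..b, f u) := by
  rw [intervalIntegral.integral_of_le hab, ofReal_integral_eq_lintegral_ofReal hf.1
    (ae_restrict_of_forall_mem measurableSet_Ioc h0)]

theorem intervalIntegrable_of_nonneg_of_le {f : ℝ → ℝ} {C : ℝ} (hf : Measurable f)
    (h0 : ∀ u, 0 ≤ f u) (hC : ∀ u, f u ≤ C) (a b : ℝ) : IntervalIntegrable f volume a b :=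
  (intervalIntegrable_const (c := C)).mono_fun hf.aestronglyMeasurable
    (ae_of_all _ fun u => by
      simpa only [Real.norm_of_nonneg (h0 u)] using (hC u).trans (Real.le_norm_self C))

theorem continuous_exp_neg_integral {f : ℝ → ℝ} {C : ℝ} (hf : Measurable f)
    (h0 : ∀ u, 0 ≤ f u) (hC : ∀ u, f u ≤ C) :
    Continuous fun u => Real.exp (-∫ v in (0)..u, f v) :=
  Real.continuous_exp.comp (intervalIntegral.continuous_primitive
    (intervalIntegrable_of_nonneg_of_le hf h0 hC) 0).neg

/-- The survival function `exp (-∫ f)` is only absolutely continuous, since `f` is merely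
measurable; hence integration by parts is used in its absolutely continuous form. -/
theorem integral_exp_neg_integral_mul {f : ℝ → ℝ} {C : ℝ} (hf : Measurable f)
    (h0 : ∀ u, 0 ≤ f u) (hC : ∀ u, f u ≤ C) {g d : ℝ → ℝ} (hg : ∀ u, HasDerivAt g (-d u) u)
    (hd : Continuous d) {s : ℝ} (hs : 0 ≤ s) :
    ∫ u in (0)..s, Real.exp (-∫ v in (0)..u, f v) * (f u * g u + d u) =
      g 0 - Real.exp (-∫ v in (0)..s, f v) * g s := by
  set h : ℝ → ℝ := fun u => f u * Real.exp (-∫ v in (0)..u, f v) with hh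
  set E : ℝ → ℝ := fun u => 1 - ∫ v in (0)..u, h v with hE
  have hE_exp : ∀ u, 0 ≤ u → E u = Real.exp (-∫ v in (0)..u, f v) := fun u hu => by
    simp only [hE, hh, integral_mul_exp_neg_integral f C hf h0 hC u hu, sub_sub_cancel]
  have hh_int : IntervalIntegrable h volume 0 s :=
    (intervalIntegrable_of_nonneg_of_le hf h0 hC 0 s).mul_continuousOn
      (continuous_exp_neg_integral hf h0 hC).continuousOn
  have hE_ac : AbsolutelyContinuousOnInterval E 0 s :=
    (contDiff_const (n := 1)).contDiffOn.absolutelyContinuousOnInterval.sub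
      (hh_int.absolutelyContinuousOnInterval_intervalIntegral Set.left_mem_uIcc)
  have hg_deriv : deriv g = fun u => -d u := funext fun u => (hg u).deriv
  have hg_ac : AbsolutelyContinuousOnInterval g 0 s :=
    (contDiff_one_iff_deriv.2 ⟨fun u => (hg u).differentiableAt,
      hg_deriv ▸ hd.neg⟩).contDiffOn.absolutelyContinuousOnInterval
  have by_parts := hE_ac.integral_deriv_mul_eq_sub hg_ac
  rw [hE_exp s hs, hE_exp 0 le_rfl, intervalIntegral.integral_same, neg_zero, Real.exp_zero,
    one_mul] at by_parts
  rw [← neg_sub, ← by_parts, ← intervalIntegral.integral_neg]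
  refine intervalIntegral.integral_congr_ae ?_
  filter_upwards [hh_int.ae_hasDerivAt_integral] with u hu hmem
  have hE_deriv : HasDerivAt E (-h u) u := by
    simpa using (hu (Set.uIoc_subset_uIcc hmem) 0 Set.left_mem_uIcc).const_sub 1
  rw [Set.uIoc_of_le hs] at hmem
  rw [hE_deriv.deriv, hg_deriv, hE_exp u hmem.1.le, hh]
  ring

theorem exp_neg_setLIntegral_Ioc {l : ℝ → ℝ≥0∞} (hl : Measurable l) {C : ℝ≥0∞} (hC : C ≠ ⊤)
    (hle : ∀ u, l u ≤ C) {u : ℝ} (hu : 0 ≤ u) :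
    EReal.exp (-((∫⁻ v in Set.Ioc 0 u, l v : ℝ≥0∞) : EReal)) =
      ENNReal.ofReal (Real.exp (-∫ v in (0)..u, (l v).toReal)) := by
  have hint := intervalIntegrable_of_nonneg_of_le hl.ennreal_toReal
    (fun _ => ENNReal.toReal_nonneg) (fun v => ENNReal.toReal_mono hC (hle v)) 0 u
  have hlf : ∀ v, l v = ENNReal.ofReal (l v).toReal := fun v =>
    (ENNReal.ofReal_toReal (ne_top_of_le_ne_top hC (hle v))).symm
  rw [lintegral_congr hlf, setLIntegral_ofReal_eq_ofReal_intervalIntegral hu hint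
      fun _ _ => ENNReal.toReal_nonneg, EReal.coe_ennreal_ofReal,
    max_eq_left (intervalIntegral.integral_nonneg hu fun _ _ => ENNReal.toReal_nonneg),
    ← EReal.coe_neg, EReal.exp_coe]

theorem exp_neg_mul_add_setLIntegral_exp_neg_mul {l : ℝ → ℝ≥0∞} (hl : Measurable l) {C : ℝ≥0∞}
    (hC : C ≠ ⊤) (hle : ∀ u, l u ≤ C) {g d : ℝ → ℝ} (hg : ∀ u, HasDerivAt g (-d u) u)
    (hd : Continuous d) {s : ℝ} (hs : 0 ≤ s) (hg0 : ∀ u ≤ s, 0 ≤ g u) (hd0 : ∀ u, 0 ≤ d u) :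
    EReal.exp (-((∫⁻ v in Set.Ioc 0 s, l v : ℝ≥0∞) : EReal)) * ENNReal.ofReal (g s) +
      ∫⁻ u in Set.Ioc 0 s, EReal.exp (-((∫⁻ v in Set.Ioc 0 u, l v : ℝ≥0∞) : EReal)) *
        (l u * ENNReal.ofReal (g u) + ENNReal.ofReal (d u)) = ENNReal.ofReal (g 0) := by
  set f : ℝ → ℝ := fun u => (l u).toReal
  have hf : Measurable f := hl.ennreal_toReal
  have hf0 : ∀ u, 0 ≤ f u := fun u => ENNReal.toReal_nonneg
  have hfC : ∀ u, f u ≤ C.toReal := fun u => ENNReal.toReal_mono hC (hle u)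
  have hlf : ∀ u, l u = ENNReal.ofReal (f u) := fun u =>
    (ENNReal.ofReal_toReal (ne_top_of_le_ne_top hC (hle u))).symm
  have hg_cont : Continuous g := continuous_iff_continuousAt.2 fun u => (hg u).continuousAt
  set j : ℝ → ℝ := fun u => Real.exp (-∫ v in (0)..u, f v) * (f u * g u + d u)
  have hj0 : ∀ u ∈ Set.Icc 0 s, 0 ≤ j u := fun u hu =>
    mul_nonneg (Real.exp_pos _).le (add_nonneg (mul_nonneg (hf0 u) (hg0 u hu.2)) (hd0 u))
  have hj_int : IntervalIntegrable j volume 0 s :=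
    (((intervalIntegrable_of_nonneg_of_le hf hf0 hfC 0 s).mul_continuousOn
      hg_cont.continuousOn).add (hd.intervalIntegrable 0 s)).continuousOn_mul
      (continuous_exp_neg_integral hf hf0 hfC).continuousOn
  have hj_ofReal : ∀ u ∈ Set.Ioc 0 s,
      EReal.exp (-((∫⁻ v in Set.Ioc 0 u, l v : ℝ≥0∞) : EReal)) *
        (l u * ENNReal.ofReal (g u) + ENNReal.ofReal (d u)) = ENNReal.ofReal (j u) := by
    intro u hu
    rw [exp_neg_setLIntegral_Ioc hl hC hle hu.1.le, hlf u, ← ENNReal.ofReal_mul (hf0 u),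
      ← ENNReal.ofReal_add (mul_nonneg (hf0 u) (hg0 u hu.2)) (hd0 u),
      ← ENNReal.ofReal_mul (Real.exp_pos _).le]
  rw [setLIntegral_congr_fun measurableSet_Ioc hj_ofReal,
    setLIntegral_ofReal_eq_ofReal_intervalIntegral hs hj_int fun u hu =>
      hj0 u (Set.Ioc_subset_Icc_self hu),
    exp_neg_setLIntegral_Ioc hl hC hle hs, ← ENNReal.ofReal_mul (Real.exp_pos _).le,
    ← ENNReal.ofReal_add (mul_nonneg (Real.exp_pos _).le (hg0 s le_rfl))
      (intervalIntegral.integral_nonneg hs hj0),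
    integral_exp_neg_integral_mul hf hf0 hfC hg hd hs, add_sub_cancel]

end ExponentialSurvival

section GrowthBound

/-- The solution `r ↦ e^{ρ r} v + (b / ρ) (e^{ρ r} - 1)` of `y' = ρ y + b`, `y 0 = v`, read as
`v + b r` for `ρ = 0`. It bounds the expected weight after time `r` of a process started at
weight `v`. -/
noncomputable def growthBound (ρ b r v : ℝ) : ℝ :=
  Real.exp (ρ * r) * v + if ρ = 0 then b * r else b / ρ * (Real.exp (ρ * r) - 1)

theorem growthBound_zero_time (ρ b v : ℝ) : growthBound ρ b 0 v = v := by simp [growthBound]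

theorem growthBound_eq_exp_mul_add (ρ b r v : ℝ) :
    growthBound ρ b r v = Real.exp (ρ * r) * v + growthBound ρ b r 0 := by simp [growthBound]

theorem continuous_growthBound (ρ b : ℝ) :
    Continuous fun p : ℝ × ℝ => growthBound ρ b p.1 p.2 := by
  by_cases hρ : ρ = 0 <;> simp only [growthBound, hρ, if_true, if_false] <;> fun_prop

theorem hasDerivAt_exp_const_mul (k r : ℝ) :
    HasDerivAt (fun r => Real.exp (k * r)) (Real.exp (k * r) * k) r := by
  simpa using ((hasDerivAt_id r).const_mul k).exp

theorem hasDerivAt_growthBound (ρ b r v : ℝ) :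
    HasDerivAt (fun r => growthBound ρ b r v) (Real.exp (ρ * r) * (ρ * v + b)) r := by
  by_cases hρ : ρ = 0
  · simp only [growthBound, hρ, if_true]
    simpa using ((hasDerivAt_id r).const_mul b).const_add v
  · simp only [growthBound, hρ, if_false]
    have he := hasDerivAt_exp_const_mul ρ r
    refine ((he.mul_const v).add ((he.sub_const 1).const_mul (b / ρ))).congr_deriv ?_
    field_simp

theorem growthBound_zero_weight_nonneg {ρ b r : ℝ} (hρ : 0 ≤ ρ) (hb : 0 ≤ b) (hr : 0 ≤ r) :
    0 ≤ growthBound ρ b r 0 := by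
  have hexp : 0 ≤ Real.exp (ρ * r) - 1 := sub_nonneg.2 (Real.one_le_exp (mul_nonneg hρ hr))
  unfold growthBound
  split_ifs <;> positivity

theorem le_growthBound {ρ b r v : ℝ} (hρ : 0 ≤ ρ) (hb : 0 ≤ b) (hr : 0 ≤ r) (hv : 0 ≤ v) :
    v ≤ growthBound ρ b r v := by
  rw [growthBound_eq_exp_mul_add]
  exact le_add_of_le_of_nonneg (le_mul_of_one_le_left hv (Real.one_le_exp (mul_nonneg hρ hr)))
    (growthBound_zero_weight_nonneg hρ hb hr)

theorem growthBound_nonneg {ρ b r v : ℝ} (hρ : 0 ≤ ρ) (hb : 0 ≤ b) (hr : 0 ≤ r) (hv : 0 ≤ v) :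
    0 ≤ growthBound ρ b r v :=
  hv.trans (le_growthBound hρ hb hr hv)

theorem setLIntegral_Ioi_deriv_le {P p : ℝ → ℝ} {a c : ℝ} (hP : ∀ t, HasDerivAt P (p t) t)
    (hp : Continuous p) (hp0 : ∀ t ∈ Set.Ioi a, 0 ≤ p t) (hPc : ∀ t ∈ Set.Ioi a, P t ≤ c) :
    ∫⁻ t in Set.Ioi a, ENNReal.ofReal (p t) ≤ ENNReal.ofReal (c - P a) := by
  have hcover : AECover (volume.restrict (Set.Ioi a)) atTop fun s : ℝ => Set.Iic s :=
    aecover_Iic tendsto_id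
  refine le_of_tendsto (hcover.lintegral_tendsto_of_countably_generated
    hp.measurable.ennreal_ofReal.aemeasurable) ?_
  filter_upwards [eventually_gt_atTop a] with s hs
  rw [Measure.restrict_restrict measurableSet_Iic, Set.Iic_inter_Ioi,
    setLIntegral_ofReal_eq_ofReal_intervalIntegral hs.le (hp.intervalIntegrable a s)
      fun t ht => hp0 t ht.1,
    intervalIntegral.integral_eq_sub_of_hasDerivAt (fun t _ => hP t) (hp.intervalIntegrable a s)]
  exact ENNReal.ofReal_le_ofReal (sub_le_sub_right (hPc s hs) _)

/-- The antiderivative comes from integrating by parts once: `growthBound' = e^{ρ t} (ρ v + b)`. -/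
theorem hasDerivAt_exp_mul_growthBound_primitive {ρ α : ℝ} (hα : α ≠ 0) (hρα : α - ρ ≠ 0)
    (b v t : ℝ) :
    HasDerivAt (fun t => -(Real.exp (-α * t) * growthBound ρ b t v +
      Real.exp (-(α - ρ) * t) * ((ρ * v + b) / (α - ρ))) / α)
      (Real.exp (-α * t) * growthBound ρ b t v) t := by
  refine (((((hasDerivAt_exp_const_mul (-α) t).mul (hasDerivAt_growthBound ρ b t v)).add
    ((hasDerivAt_exp_const_mul (-(α - ρ)) t).mul_const
      ((ρ * v + b) / (α - ρ)))).neg.div_const α)).congr_deriv ?_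
  have hexp : Real.exp (-(α - ρ) * t) = Real.exp (-α * t) * Real.exp (ρ * t) := by
    rw [← Real.exp_add]; ring_nf
  rw [hexp]
  field_simp
  ring

theorem setLIntegral_exp_mul_growthBound_le {ρ b α v : ℝ} (hρ : 0 ≤ ρ) (hb : 0 ≤ b)
    (hα : ρ < α) (hv : 0 ≤ v) :
    ∫⁻ t in Set.Ioi (0 : ℝ), ENNReal.ofReal (Real.exp (-α * t) * growthBound ρ b t v) ≤
      ENNReal.ofReal ((α * v + b) / (α * (α - ρ))) := by
  have hα0 : 0 < α := hρ.trans_lt hα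
  have hαρ : 0 < α - ρ := sub_pos.2 hα
  have hcont : Continuous fun t => Real.exp (-α * t) * growthBound ρ b t v :=
    (by fun_prop : Continuous fun t => Real.exp (-α * t)).mul
      ((continuous_growthBound ρ b).comp (continuous_id.prodMk continuous_const))
  have hnonneg : ∀ t ∈ Set.Ioi (0 : ℝ), 0 ≤ Real.exp (-α * t) * growthBound ρ b t v :=
    fun t ht => mul_nonneg (Real.exp_pos _).le (growthBound_nonneg hρ hb (le_of_lt ht) hv)
  refine (setLIntegral_Ioi_deriv_le (c := 0)
    (hasDerivAt_exp_mul_growthBound_primitive hα0.ne' hαρ.ne' b v) hcont hnonneg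
    fun t ht => div_nonpos_of_nonpos_of_nonneg (neg_nonpos.2 ?_) hα0.le).trans_eq ?_
  · have hgrowth := hnonneg t ht
    positivity
  · congr 1
    simp only [growthBound_zero_time, mul_zero, Real.exp_zero]
    field_simp
    ring

end GrowthBound

section Path

variable {S : Type*} {t : ℝ≥0} {ω : Path S}

theorem jumpTime_succ (m : ℕ) (ω : Path S) :
    jumpTime (m + 1) ω = jumpTime m ω + sojourn (m + 1) ω :=
  Finset.sum_range_succ _ _

theorem jumpTime_zero (ω : Path S) : jumpTime 0 ω = 0 := by
  simpa [jumpTime, sojourn] using ω.2.1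

theorem jumpTime_mono (ω : Path S) : Monotone fun m => jumpTime m ω :=
  monotone_nat_of_le_succ fun m => jumpTime_succ m ω ▸ le_self_add

theorem sojourn_le_jumpTime (m : ℕ) (ω : Path S) : sojourn m ω ≤ jumpTime m ω :=
  Finset.single_le_sum_of_canonicallyOrdered (f := fun i => sojourn i ω)
    (Finset.self_mem_range_succ m)

theorem mark_eq_inl_of_jumpTime_le [MeasurableSpace S] [StandardBorelSpace S] {m : ℕ}
    (h : jumpTime m ω ≤ t) :
    ∃ x, mark m ω = Sum.inl x :=
  mark_eq_inl (ne_top_of_le_ne_top ENNReal.coe_ne_top ((sojourn_le_jumpTime m ω).trans h))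

theorem mark_freeze {i k : ℕ} (hi : i ≤ k) (ω : Path S) : mark i (freeze k ω) = mark i ω := by
  simp [mark, freeze, hi]

theorem jumpTime_freeze {i k : ℕ} (hi : i ≤ k) (ω : Path S) :
    jumpTime i (freeze k ω) = jumpTime i ω :=
  Finset.sum_congr rfl fun j hj => by
    have hjk : j ≤ k := (Finset.mem_range_succ_iff.1 hj).trans hi
    simp [sojourn, freeze, hjk]

theorem jumpTime_succ_freeze (k : ℕ) (ω : Path S) : jumpTime (k + 1) (freeze k ω) = ⊤ := by
  rw [jumpTime_succ]
  simp [sojourn, freeze]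

theorem state_eq_mark {m : ℕ} (h : jumpTime m ω ≤ t) (h' : t < jumpTime (m + 1) ω) :
    state t ω = mark m ω := by
  have hex : ∃ m, jumpTime m ω ≤ t ∧ (t : ℝ≥0∞) < jumpTime (m + 1) ω := ⟨m, h, h'⟩
  rw [state, dif_pos hex, (jumpTime_mono ω).pairwise_disjoint_on_Ico_succ.eq
    (Set.not_disjoint_iff.2 ⟨t, hex.choose_spec, h, h'⟩)]

theorem leftState_eq_mark {m : ℕ} (h : jumpTime m ω < t) (h' : t ≤ jumpTime (m + 1) ω) :
    leftState t ω = mark m ω := by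
  have hex : ∃ m, jumpTime m ω < t ∧ (t : ℝ≥0∞) ≤ jumpTime (m + 1) ω := ⟨m, h, h'⟩
  have ht : t ≠ 0 := by
    rintro rfl
    simp at h
  rw [leftState, if_neg ht, dif_pos hex, (jumpTime_mono ω).pairwise_disjoint_on_Ioc_succ.eq
    (Set.not_disjoint_iff.2 ⟨t, hex.choose_spec, h, h'⟩)]

theorem leftState_eq_state (h : ∀ m, jumpTime m ω ≠ t) : leftState t ω = state t ω := by
  by_cases hm : ∃ m, jumpTime m ω ≤ t ∧ (t : ℝ≥0∞) < jumpTime (m + 1) ω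
  · obtain ⟨m, h1, h2⟩ := hm
    rw [state_eq_mark h1 h2, leftState_eq_mark (lt_of_le_of_ne h1 (h m)) h2.le]
  · have ht : t ≠ 0 := by
      rintro rfl
      exact h 0 (by simp [jumpTime_zero])
    rw [state, dif_neg hm, leftState, if_neg ht, dif_neg]
    rintro ⟨m, h1, h2⟩
    exact hm ⟨m, h1.le, lt_of_le_of_ne h2 (h (m + 1)).symm⟩

theorem exists_jumpTime_le_lt {n : ℕ} (h : t < jumpTime n ω) :
    ∃ m < n, jumpTime m ω ≤ t ∧ t < jumpTime (m + 1) ω := by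
  induction n with
  | zero => simp [jumpTime_zero] at h
  | succ n ih =>
    rcases lt_or_ge (t : ℝ≥0∞) (jumpTime n ω) with hn | hn
    · obtain ⟨m, hm, hmt⟩ := ih hn
      exact ⟨m, hm.trans n.lt_succ_self, hmt⟩
    · exact ⟨n, n.lt_succ_self, hn, h⟩

theorem exists_state_eq_mark {n : ℕ} (h : t < jumpTime n ω) :
    ∃ m < n, jumpTime m ω ≤ t ∧ state t ω = mark m ω := by
  obtain ⟨m, hm, h1, h2⟩ := exists_jumpTime_le_lt h
  exact ⟨m, hm, h1, state_eq_mark h1 h2⟩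

theorem state_mem_range_inl [MeasurableSpace S] [StandardBorelSpace S]
    (h : explosionTime ω = ⊤) (t : ℝ≥0) :
    state t ω ∈ Set.range Sum.inl := by
  obtain ⟨n, hn⟩ := lt_iSup_iff.1 (h ▸ ENNReal.coe_lt_top : (t : ℝ≥0∞) < explosionTime ω)
  obtain ⟨m, -, hmt, hm⟩ := exists_state_eq_mark hn
  exact hm ▸ (mark_eq_inl_of_jumpTime_le hmt).imp fun _ => Eq.symm

theorem state_freeze_of_lt_jumpTime {k : ℕ} (h : t < jumpTime (k + 1) ω) :
    state t (freeze k ω) = state t ω := by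
  obtain ⟨m, hm, h1, h2⟩ := exists_jumpTime_le_lt h
  have hmk : m ≤ k := Nat.lt_succ_iff.1 hm
  rw [state_eq_mark h1 h2, ← mark_freeze hmk]
  refine state_eq_mark (by rwa [jumpTime_freeze hmk]) ?_
  rcases hmk.eq_or_lt with rfl | hlt
  · exact jumpTime_succ_freeze m ω ▸ ENNReal.coe_lt_top
  · rwa [jumpTime_freeze hlt]

theorem state_freeze_of_jumpTime_le {k : ℕ} (h : jumpTime k ω ≤ t) :
    state t (freeze k ω) = mark k ω := by
  rw [← mark_freeze le_rfl ω]
  exact state_eq_mark (by rwa [jumpTime_freeze le_rfl])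
    (jumpTime_succ_freeze k ω ▸ ENNReal.coe_lt_top)

theorem sum_indicator_one_lt_sojourn_le (t : ℝ≥0) (ω : Path S) (n : ℕ) :
    ∑ m ∈ Finset.range n, {ω | jumpTime m ω ≤ t ∧ 1 < sojourn (m + 1) ω}.indicator
      (1 : Path S → ℝ≥0∞) ω ≤ min (jumpTime n ω) (t + 1) := by
  induction n with
  | zero => simp
  | succ n ih =>
    rw [Finset.sum_range_succ, jumpTime_succ]
    by_cases h : jumpTime n ω ≤ t ∧ 1 < sojourn (n + 1) ω
    · have hsum := ih.trans (min_le_left _ _)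
      rw [Set.indicator_of_mem (Set.mem_ofPred_eq ▸ h), Pi.one_apply]
      exact le_min (add_le_add hsum h.2.le) (add_le_add_left (hsum.trans h.1) 1)
    · rw [Set.indicator_of_notMem (Set.mem_ofPred_eq ▸ h), add_zero]
      exact ih.trans (min_le_min le_self_add le_rfl)

theorem measurable_state [MeasurableSpace S] :
    Measurable fun p : Path S × ℝ≥0 => state p.2 p.1 := by
  let epoch (m : ℕ) : Set (Path S × ℝ≥0) :=
    {p | jumpTime m p.1 ≤ p.2 ∧ (p.2 : ℝ≥0∞) < jumpTime (m + 1) p.1}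
  have hepoch : ∀ m, MeasurableSet (epoch m) := fun m =>
    (measurableSet_le ((measurable_jumpTime m).comp measurable_fst)
      measurable_snd.coe_nnreal_ennreal).inter
      (measurableSet_lt measurable_snd.coe_nnreal_ennreal
        ((measurable_jumpTime (m + 1)).comp measurable_fst))
  intro Γ hΓ
  have hpre : (fun p : Path S × ℝ≥0 => state p.2 p.1) ⁻¹' Γ =
      (⋃ m, epoch m ∩ (fun p => mark m p.1) ⁻¹' Γ) ∪
        ((⋂ m, (epoch m)ᶜ) ∩ {_p | (Sum.inr () : S ⊕ Unit) ∈ Γ}) := by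
    ext p
    by_cases h : ∃ m, p ∈ epoch m
    · have hne : ¬∀ m, p ∉ epoch m := not_forall_not.2 h
      have hmark : ∀ {m}, p ∈ epoch m → state p.2 p.1 = mark m p.1 := fun hm =>
        state_eq_mark hm.1 hm.2
      simp only [Set.mem_preimage, Set.mem_union, Set.mem_iUnion, Set.mem_inter_iff,
        Set.mem_iInter, Set.mem_compl_iff, hne, false_and, or_false]
      refine ⟨fun hΓ => h.imp fun m hm => ⟨hm, hmark hm ▸ hΓ⟩, ?_⟩
      rintro ⟨m, hm, hΓ⟩
      exact hmark hm ▸ hΓ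
    · have hstate : state p.2 p.1 = Sum.inr () := dif_neg h
      have hall : ∀ m, p ∉ epoch m := not_exists.1 h
      simp [hstate, hall]
  rw [hpre]
  exact (MeasurableSet.iUnion fun m =>
    (hepoch m).inter (((measurable_mark m).comp measurable_fst) hΓ)).union
      ((MeasurableSet.iInter fun m => (hepoch m).compl).inter (MeasurableSet.const _))

end Path

section Drift

variable {S A : Type*} [MeasurableSpace S] [MeasurableSpace A] {M : CTMDP S A} {w : S → ℝ}
  {ρ b : ℝ} {x : S} {a : A}

/-- The drift inequality `∫ w dq(· | x, a) ≤ ρ w(x) + b` for a nonnegative weight `w`: the part of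
`LyapunovCondition` that does not refer to the exhausting sequence. -/
structure DriftCondition (M : CTMDP S A) (w : S → ℝ) (ρ b : ℝ) : Prop where
  measurable_w : Measurable w
  w_nonneg : ∀ x, 0 ≤ w x
  rho_nonneg : 0 ≤ ρ
  b_nonneg : 0 ≤ b
  drift : ∀ x, ∀ a ∈ M.adm x, Integrable w (M.q x a).totalVariation ∧
    ∫ y, w y ∂(M.q x a).toJordanDecomposition.posPart -
      ∫ y, w y ∂(M.q x a).toJordanDecomposition.negPart ≤ ρ * w x + b

theorem LyapunovCondition.driftCondition {Sl : ℕ → Set S}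
    (hL : M.LyapunovCondition w ρ b Sl) : M.DriftCondition w ρ b where
  measurable_w := hL.measurable_w
  w_nonneg x := zero_le_one.trans (hL.one_le_w x)
  rho_nonneg := hL.rho_nonneg
  b_nonneg := hL.b_nonneg
  drift := hL.drift

theorem LyapunovCondition.exists_maxRate_lt_top_le_weight {Sl : ℕ → Set S}
    (hL : M.LyapunovCondition w ρ b Sl) (R : ℝ) :
    ∃ B, MeasurableSet B ∧ (⨆ x ∈ B, M.maxRate x) < ⊤ ∧ ∀ x ∉ B, R ≤ w x := by
  obtain ⟨l, hl⟩ := (hL.tendsto_iInf.eventually (lt_mem_nhds (EReal.coe_lt_top R))).exists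
  exact ⟨Sl l, hL.measurableSet_Sl l, hL.rates_bounded l, fun x hx =>
    EReal.coe_le_coe_iff.1 (hl.le.trans (iInf₂_le x hx))⟩

theorem ae_policy_freeze_mem (π : M.Policy) {k : ℕ} {ω : Path S} (hx : mark k ω = Sum.inl x)
    (hT : jumpTime k ω ≠ ⊤) {u : ℝ} (hu : 0 < u) :
    ∀ᵐ a ∂π.toFun (freeze k ω) ((jumpTime k ω).toNNReal + u.toNNReal),
      a ∈ Sum.inl '' M.adm x := by
  set t : ℝ≥0 := (jumpTime k ω).toNNReal + u.toNNReal
  have hleft : leftState t (freeze k ω) = Sum.inl x := by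
    rw [← hx, ← mark_freeze le_rfl ω]
    refine leftState_eq_mark ?_ (jumpTime_succ_freeze k ω ▸ le_top)
    rw [jumpTime_freeze le_rfl, ENNReal.coe_add, ENNReal.coe_toNNReal hT]
    exact ENNReal.lt_add_right hT (by simpa using hu)
  have hconc : ∀ᵐ a ∂π.toFun (freeze k ω) t, a ∈ M.extAdm (leftState t (freeze k ω)) :=
    π.concentrated _ _
  rwa [hleft] at hconc

variable [StandardBorelSpace S]

theorem q_sdiff_singleton (M : CTMDP S A) {Γ : Set S} (hΓ : MeasurableSet Γ) (hx : x ∈ Γ) :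
    M.q x a (Γ \ {x}) = M.q x a Γ - M.q x a {x} :=
  eq_sub_of_add_eq' (VectorMeasure.of_add_of_sdiff (MeasurableSet.singleton x) hΓ
    (Set.singleton_subset_iff.2 hx))

theorem q_univ_sdiff_singleton (M : CTMDP S A) (ha : a ∈ M.adm x) :
    M.q x a (Set.univ \ {x}) = -M.q x a {x} := by
  rw [M.q_sdiff_singleton MeasurableSet.univ (Set.mem_univ x), M.q_univ x a ha, zero_sub]

theorem neg_q_singleton_nonneg (M : CTMDP S A) (ha : a ∈ M.adm x) : 0 ≤ -M.q x a {x} :=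
  M.q_univ_sdiff_singleton ha ▸
    M.q_nonneg x a ha _ (MeasurableSet.univ.diff (MeasurableSet.singleton x)) (by simp)

theorem jumpMeasure_univ (M : CTMDP S A) (ha : a ∈ M.adm x) :
    M.jumpMeasure (Sum.inl x) (Sum.inl a) Set.univ = ENNReal.ofReal (-M.q x a {x}) := by
  rw [M.jumpMeasure_apply ha MeasurableSet.univ, M.q_univ_sdiff_singleton ha]

/-- The Jordan decomposition of `q(· | x, a)`, whose positive part lives off `{x}` and whose
negative part is the point mass `q_x(a) δ_x`. -/
noncomputable def rateJordanDecomposition (M : CTMDP S A) (ha : a ∈ M.adm x) :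
    JordanDecomposition S where
  posPart := M.jumpMeasure (Sum.inl x) (Sum.inl a)
  negPart := ENNReal.ofReal (-M.q x a {x}) • Measure.dirac x
  posPart_finite := ⟨(M.jumpMeasure_univ_le x _).trans_lt (M.q_stable x)⟩
  negPart_finite := Measure.smul_finite _ ENNReal.ofReal_ne_top
  mutuallySingular := by
    refine ⟨{x}, MeasurableSet.singleton x, ?_, by simp⟩
    rw [M.jumpMeasure_apply ha (MeasurableSet.singleton x)]
    simp

theorem toSignedMeasure_rateJordanDecomposition (M : CTMDP S A) (ha : a ∈ M.adm x) :
    (M.rateJordanDecomposition ha).toSignedMeasure = M.q x a := by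
  refine VectorMeasure.ext fun Γ hΓ => ?_
  have hoff : 0 ≤ M.q x a (Γ \ {x}) :=
    M.q_nonneg x a ha _ (hΓ.diff (MeasurableSet.singleton x)) (by simp)
  rw [JordanDecomposition.toSignedMeasure, Measure.toSignedMeasure_sub_apply hΓ]
  simp only [rateJordanDecomposition, Measure.real]
  rw [M.jumpMeasure_apply ha hΓ, ENNReal.toReal_ofReal hoff, Measure.smul_apply,
    Measure.dirac_apply' _ hΓ]
  by_cases hx : x ∈ Γ
  · simp only [hx, Set.indicator_of_mem, Pi.one_apply, smul_eq_mul, mul_one,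
      ENNReal.toReal_ofReal (M.neg_q_singleton_nonneg ha), M.q_sdiff_singleton hΓ hx]
    ring
  · simp [hx]

theorem toJordanDecomposition_q (M : CTMDP S A) (ha : a ∈ M.adm x) :
    (M.q x a).toJordanDecomposition = M.rateJordanDecomposition ha :=
  SignedMeasure.toJordanDecomposition_eq (M.toSignedMeasure_rateJordanDecomposition ha).symm

theorem DriftCondition.lintegral_jumpMeasure_le (hM : M.DriftCondition w ρ b)
    (ha : a ∈ M.adm x) :
    ∫⁻ y, ENNReal.ofReal (w y) ∂M.jumpMeasure (Sum.inl x) (Sum.inl a) ≤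
      M.jumpMeasure (Sum.inl x) (Sum.inl a) Set.univ * ENNReal.ofReal (w x) +
        ENNReal.ofReal (ρ * w x + b) := by
  obtain ⟨hint, hdrift⟩ := hM.drift x a ha
  have hq := M.neg_q_singleton_nonneg ha
  have hw := hM.w_nonneg
  rw [SignedMeasure.totalVariation, M.toJordanDecomposition_q ha] at hint
  have hintJ : Integrable w (M.jumpMeasure (Sum.inl x) (Sum.inl a)) := hint.left_of_add_measure
  rw [M.toJordanDecomposition_q ha] at hdrift
  simp only [rateJordanDecomposition, integral_smul_measure,
    integral_dirac' _ _ hM.measurable_w.stronglyMeasurable, ENNReal.toReal_ofReal hq,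
    smul_eq_mul, sub_le_iff_le_add'] at hdrift
  rw [← ofReal_integral_eq_lintegral_ofReal hintJ (ae_of_all _ hw),
    M.jumpMeasure_univ ha, ← ENNReal.ofReal_mul hq,
    ← ENNReal.ofReal_add (mul_nonneg hq (hw x))
      (add_nonneg (mul_nonneg hM.rho_nonneg (hw x)) hM.b_nonneg)]
  exact ENNReal.ofReal_le_ofReal hdrift

theorem DriftCondition.lintegral_intensity_le (hM : M.DriftCondition w ρ b) (π : M.Policy)
    {k : ℕ} {ω : Path S} (hx : mark k ω = Sum.inl x) (hT : jumpTime k ω ≠ ⊤) {u : ℝ}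
    (hu : 0 < u) :
    ∫⁻ y, ENNReal.ofReal (w y) ∂intensity π k ω u ≤
      intensity π k ω u Set.univ * ENNReal.ofReal (w x) + ENNReal.ofReal (ρ * w x + b) := by
  have hprob := π.isProbabilityMeasure (freeze k ω) ((jumpTime k ω).toNNReal + u.toNNReal)
  have hJ := M.measurable_jumpMeasure_right (Sum.inl x)
  rw [intensity, hx, Measure.lintegral_bind hJ.aemeasurable
    hM.measurable_w.ennreal_ofReal.aemeasurable, Measure.bind_apply MeasurableSet.univ
    hJ.aemeasurable, ← lintegral_mul_const (f := fun a => M.jumpMeasure (Sum.inl x) a Set.univ) _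
      ((Measure.measurable_coe MeasurableSet.univ).comp hJ)]
  calc _ ≤ ∫⁻ a, M.jumpMeasure (Sum.inl x) a Set.univ * ENNReal.ofReal (w x) +
        ENNReal.ofReal (ρ * w x + b)
          ∂π.toFun (freeze k ω) ((jumpTime k ω).toNNReal + u.toNNReal) := by
        refine lintegral_mono_ae ((ae_policy_freeze_mem π hx hT hu).mono ?_)
        rintro _ ⟨a, ha, rfl⟩
        exact hM.lintegral_jumpMeasure_le ha
    _ = _ := by
        rw [lintegral_add_right _ measurable_const, lintegral_const, measure_univ, mul_one]

theorem DriftCondition.lintegral_growthBound_intensity_le (hM : M.DriftCondition w ρ b)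
    (π : M.Policy) {k : ℕ} {ω : Path S} (hx : mark k ω = Sum.inl x) (hT : jumpTime k ω ≠ ⊤)
    {u : ℝ} (hu : 0 < u) {r : ℝ} (hr : 0 ≤ r) :
    ∫⁻ y, ENNReal.ofReal (growthBound ρ b r (w y)) ∂intensity π k ω u ≤
      intensity π k ω u Set.univ * ENNReal.ofReal (growthBound ρ b r (w x)) +
        ENNReal.ofReal (Real.exp (ρ * r) * (ρ * w x + b)) := by
  have hexp := (Real.exp_pos (ρ * r)).le
  have haffine : ∀ y, ENNReal.ofReal (growthBound ρ b r (w y)) =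
      ENNReal.ofReal (Real.exp (ρ * r)) * ENNReal.ofReal (w y) +
        ENNReal.ofReal (growthBound ρ b r 0) := fun y => by
    rw [growthBound_eq_exp_mul_add, ENNReal.ofReal_add (mul_nonneg hexp (hM.w_nonneg y))
      (growthBound_zero_weight_nonneg hM.rho_nonneg hM.b_nonneg hr), ENNReal.ofReal_mul hexp]
  simp_rw [haffine]
  rw [lintegral_add_right _ measurable_const, lintegral_const,
    lintegral_const_mul _ hM.measurable_w.ennreal_ofReal, ENNReal.ofReal_mul hexp]
  grw [hM.lintegral_intensity_le π hx hT hu]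
  exact le_of_eq (by ring)

end Drift

section Step

theorem measurable_sumElim_zero {X S : Type*} [MeasurableSpace X] [MeasurableSpace S]
    {f : X → S → ℝ≥0∞} (hf : Measurable fun p : X × S => f p.1 p.2) :
    Measurable fun p : X × (S ⊕ Unit) => Sum.elim (f p.1) (fun _ => 0) p.2 := by
  have h : Measurable ((fun p : X × (S ⊕ Unit) => Sum.elim (f p.1) (fun _ => 0) p.2) ∘
      (MeasurableEquiv.prodSumDistrib X S Unit).symm) :=
    measurable_fun_sum hf (measurable_const (a := (0 : ℝ≥0∞)))
  have h' := h.comp (MeasurableEquiv.prodSumDistrib X S Unit).measurable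
  rwa [Function.comp_assoc, MeasurableEquiv.symm_comp_self] at h'

/-- The bound `growthBound ρ b r (w x)` as a function of the extended time `r` and the state,
extended by zero to `x_∞`. Its value at `r = ∞` is irrelevant. -/
noncomputable def extGrowthBound {S : Type*} (ρ b : ℝ) (w : S → ℝ) (r : ℝ≥0∞) :
    S ⊕ Unit → ℝ≥0∞ :=
  Sum.elim (fun y => ENNReal.ofReal (growthBound ρ b r.toReal (w y))) fun _ => 0

/-- The weight `w`, extended by zero to `x_∞`. -/
noncomputable def extWeight {S : Type*} (w : S → ℝ) : S ⊕ Unit → ℝ≥0∞ :=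
  Sum.elim (fun y => ENNReal.ofReal (w y)) fun _ => 0

theorem extGrowthBound_zero {S : Type*} (ρ b : ℝ) (w : S → ℝ) :
    extGrowthBound ρ b w 0 = extWeight w := by
  simp [extGrowthBound, extWeight, growthBound_zero_time]

variable {S A : Type*} [MeasurableSpace S] [MeasurableSpace A] {M : CTMDP S A} {w : S → ℝ}
  {ρ b : ℝ}

theorem measurable_extWeight (hw : Measurable w) : Measurable (extWeight w) :=
  hw.ennreal_ofReal.sumElim measurable_const

theorem measurable_extGrowthBound (ρ b : ℝ) (hw : Measurable w) :
    Measurable fun p : ℝ≥0∞ × (S ⊕ Unit) => extGrowthBound ρ b w p.1 p.2 := by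
  have hpair : Measurable fun p : ℝ≥0∞ × S => (p.1.toReal, w p.2) :=
    measurable_fst.ennreal_toReal.prodMk (hw.comp measurable_snd)
  have hreal : Measurable fun p : ℝ≥0∞ × S => growthBound ρ b p.1.toReal (w p.2) :=
    Measurable.comp (g := fun p : ℝ × ℝ => growthBound ρ b p.1 p.2)
      (continuous_growthBound ρ b).measurable hpair
  exact measurable_sumElim_zero
    (f := fun (r : ℝ≥0∞) y => ENNReal.ofReal (growthBound ρ b r.toReal (w y)))
    hreal.ennreal_ofReal

theorem DriftCondition.extWeight_le_extGrowthBound (hM : M.DriftCondition w ρ b) (r : ℝ≥0∞)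
    (z : S ⊕ Unit) : extWeight w z ≤ extGrowthBound ρ b w r z := by
  rcases z with x | _
  · exact ENNReal.ofReal_le_ofReal (le_growthBound hM.rho_nonneg hM.b_nonneg
      ENNReal.toReal_nonneg (hM.w_nonneg x))
  · exact le_rfl

variable [StandardBorelSpace S] {k : ℕ} {ω : Path S} {x : S}

theorem lintegral_stepMeasure (π : M.Policy) (hθ : sojourn k ω ≠ ⊤)
    {H : ℝ≥0∞ × (S ⊕ Unit) → ℝ≥0∞} (hH : Measurable H) :
    ∫⁻ e, H e ∂stepMeasure π k ω =
      (∫⁻ u in Set.Ioi (0 : ℝ), survival π k ω u *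
        ∫⁻ y, H (ENNReal.ofReal u, Sum.inl y) ∂intensity π k ω u) +
      noJump π k ω * H (⊤, Sum.inr ()) := by
  rw [stepMeasure, if_neg hθ, lintegral_add_measure, lintegral_smul_measure,
    lintegral_dirac' _ hH, Measure.lintegral_bind (measurable_density_right π k ω).aemeasurable
    hH.aemeasurable, smul_eq_mul]
  simp_rw [lintegral_map hH (measurable_const.prodMk measurable_inl), lintegral_smul_measure,
    smul_eq_mul]

theorem setLIntegral_stepMeasure (π : M.Policy) (hθ : sojourn k ω ≠ ⊤)
    {H : ℝ≥0∞ × (S ⊕ Unit) → ℝ≥0∞} (hH : Measurable H) (s : ℝ) :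
    ∫⁻ e in {e | e.1 ≤ ENNReal.ofReal s}, H e ∂stepMeasure π k ω =
      ∫⁻ u in Set.Ioc 0 s, survival π k ω u *
        ∫⁻ y, H (ENNReal.ofReal u, Sum.inl y) ∂intensity π k ω u := by
  have hD : MeasurableSet {e : ℝ≥0∞ × (S ⊕ Unit) | e.1 ≤ ENNReal.ofReal s} :=
    measurable_fst measurableSet_Iic
  rw [← lintegral_indicator hD, lintegral_stepMeasure π hθ (hH.indicator hD),
    Set.indicator_of_notMem (by simp), mul_zero, add_zero, ← Set.Iic_inter_Ioi,
    ← setLIntegral_indicator measurableSet_Iic]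
  refine setLIntegral_congr_fun measurableSet_Ioi fun u hu => ?_
  have hle : ENNReal.ofReal u ≤ ENNReal.ofReal s ↔ u ≤ s := by
    rw [ENNReal.ofReal_le_ofReal_iff', or_iff_left (not_le.2 hu)]
  by_cases hus : u ≤ s <;> simp [hle, hus]

theorem stepMeasure_lt (π : M.Policy) (hθ : sojourn k ω ≠ ⊤) {s : ℝ} (hs : 0 ≤ s) :
    stepMeasure π k ω {e | ENNReal.ofReal s < e.1} = survival π k ω s := by
  obtain ⟨x, hx⟩ := mark_eq_inl hθ
  have hprob := isProbabilityMeasure_stepMeasure π k ω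
  have hD : MeasurableSet {e : ℝ≥0∞ × (S ⊕ Unit) | e.1 ≤ ENNReal.ofReal s} :=
    measurable_fst measurableSet_Iic
  have hsurv : survival π k ω s + ∫⁻ u in Set.Ioc 0 s, survival π k ω u *
      intensity π k ω u Set.univ = 1 := by
    simpa only [survival, ENNReal.ofReal_one, mul_one, ENNReal.ofReal_zero, add_zero] using
      exp_neg_mul_add_setLIntegral_exp_neg_mul (measurable_intensity_univ_right π k ω)
        (M.q_stable x).ne (intensity_univ_le π k ω hx) (g := fun _ => 1) (d := fun _ => 0)
        (fun u => by simpa using hasDerivAt_const u (1 : ℝ)) continuous_const hs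
        (fun _ _ => zero_le_one) (fun _ => le_rfl)
  have hjump : stepMeasure π k ω {e | e.1 ≤ ENNReal.ofReal s} =
      ∫⁻ u in Set.Ioc 0 s, survival π k ω u * intensity π k ω u Set.univ := by
    simpa only [setLIntegral_const, lintegral_const, one_mul, Measure.restrict_apply_univ] using
      setLIntegral_stepMeasure π hθ (H := fun _ => 1) measurable_const s
  have hcompl : {e : ℝ≥0∞ × (S ⊕ Unit) | ENNReal.ofReal s < e.1} =
      {e | e.1 ≤ ENNReal.ofReal s}ᶜ := by
    ext e
    simp
  rw [hcompl, prob_compl_eq_one_sub hD, hjump, ← hsurv, ENNReal.add_sub_cancel_right]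
  exact ne_top_of_le_ne_top ENNReal.one_ne_top (hsurv ▸ le_add_self)

theorem exp_neg_maxRate_le_survival (π : M.Policy) (hx : mark k ω = Sum.inl x) :
    EReal.exp (-(M.maxRate x : EReal)) ≤ survival π k ω 1 := by
  refine EReal.exp_monotone (EReal.neg_le_neg_iff.2 (EReal.coe_ennreal_le_coe_ennreal_iff.2 ?_))
  refine (lintegral_mono fun u => intensity_univ_le π k ω hx u).trans ?_
  simp

theorem DriftCondition.survival_mul_add_setLIntegral_growthBound_le
    (hM : M.DriftCondition w ρ b) (π : M.Policy) (hx : mark k ω = Sum.inl x)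
    (hT : jumpTime k ω ≠ ⊤) {s : ℝ} (hs : 0 ≤ s) :
    survival π k ω s * ENNReal.ofReal (w x) + ∫⁻ u in Set.Ioc 0 s, survival π k ω u *
        ∫⁻ y, ENNReal.ofReal (growthBound ρ b (s - u) (w y)) ∂intensity π k ω u ≤
      ENNReal.ofReal (growthBound ρ b s (w x)) := by
  have hρ := hM.rho_nonneg
  have hb := hM.b_nonneg
  have hw := hM.w_nonneg x
  have hidentity := exp_neg_mul_add_setLIntegral_exp_neg_mul
    (measurable_intensity_univ_right π k ω) (M.q_stable x).ne (intensity_univ_le π k ω hx)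
    (g := fun u => growthBound ρ b (s - u) (w x))
    (d := fun u => Real.exp (ρ * (s - u)) * (ρ * w x + b))
    (fun u => ((hasDerivAt_growthBound ρ b (s - u) (w x)).comp u
      ((hasDerivAt_id u).const_sub s)).congr_deriv (by ring)) (by fun_prop) hs
    (fun u hu => growthBound_nonneg hρ hb (sub_nonneg.2 hu) hw) (fun u => by positivity)
  simp only [sub_self, growthBound_zero_time, sub_zero] at hidentity
  rw [← hidentity]
  refine add_le_add le_rfl (setLIntegral_mono' measurableSet_Ioc fun u hu => ?_)
  exact mul_le_mul_right
    (hM.lintegral_growthBound_intensity_le π hx hT hu.1 (sub_nonneg.2 hu.2)) _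

theorem DriftCondition.lintegral_stepMeasure_extGrowthBound_le (hM : M.DriftCondition w ρ b)
    (π : M.Policy) (hx : mark k ω = Sum.inl x) (hT : jumpTime k ω ≠ ⊤) {r : ℝ≥0∞}
    (hr : r ≠ ⊤) :
    ∫⁻ e, extGrowthBound ρ b w (r - e.1) (if r < e.1 then Sum.inl x else e.2)
      ∂stepMeasure π k ω ≤ extGrowthBound ρ b w r (Sum.inl x) := by
  obtain ⟨s, hs, rfl⟩ : ∃ s, 0 ≤ s ∧ r = ENNReal.ofReal s :=
    ⟨r.toReal, ENNReal.toReal_nonneg, (ENNReal.ofReal_toReal hr).symm⟩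
  have hθ : sojourn k ω ≠ ⊤ := ne_top_of_le_ne_top hT (sojourn_le_jumpTime k ω)
  have hD : MeasurableSet {e : ℝ≥0∞ × (S ⊕ Unit) | e.1 ≤ ENNReal.ofReal s} :=
    measurable_fst measurableSet_Iic
  have hcompl : {e : ℝ≥0∞ × (S ⊕ Unit) | e.1 ≤ ENNReal.ofReal s}ᶜ =
      {e | ENNReal.ofReal s < e.1} := by
    ext e
    simp
  have hmeas : Measurable fun e : ℝ≥0∞ × (S ⊕ Unit) =>
      extGrowthBound ρ b w (ENNReal.ofReal s - e.1) e.2 :=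
    ((measurable_extGrowthBound ρ b hM.measurable_w).comp
      ((measurable_const.sub measurable_fst).prodMk measurable_snd) :)
  have hmove : ∫⁻ e in {e | e.1 ≤ ENNReal.ofReal s}, extGrowthBound ρ b w (ENNReal.ofReal s - e.1)
      (if ENNReal.ofReal s < e.1 then Sum.inl x else e.2) ∂stepMeasure π k ω =
      ∫⁻ u in Set.Ioc 0 s, survival π k ω u *
        ∫⁻ y, ENNReal.ofReal (growthBound ρ b (s - u) (w y)) ∂intensity π k ω u := by
    rw [setLIntegral_congr_fun (g := fun e => extGrowthBound ρ b w (ENNReal.ofReal s - e.1) e.2)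
      hD fun e he => by simp only [if_neg (not_lt.2 he.out)], setLIntegral_stepMeasure π hθ
      hmeas]
    refine setLIntegral_congr_fun measurableSet_Ioc fun u hu => ?_
    simp only [extGrowthBound, ← ENNReal.ofReal_sub s hu.1.le,
      ENNReal.toReal_ofReal (sub_nonneg.2 hu.2), Sum.elim_inl]
  have hstay : ∫⁻ e in {e | ENNReal.ofReal s < e.1}, extGrowthBound ρ b w (ENNReal.ofReal s - e.1)
      (if ENNReal.ofReal s < e.1 then Sum.inl x else e.2) ∂stepMeasure π k ω =
      survival π k ω s * ENNReal.ofReal (w x) := by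
    rw [setLIntegral_congr_fun (g := fun _ => ENNReal.ofReal (w x)) (hcompl ▸ hD.compl)
      fun e he => by simp [if_pos he.out, tsub_eq_zero_of_le he.out.le, extGrowthBound_zero,
        extWeight], setLIntegral_const, stepMeasure_lt π hθ hs, mul_comm]
  rw [← lintegral_add_compl _ hD, hcompl, hmove, hstay, add_comm, extGrowthBound, Sum.elim_inl,
    ENNReal.toReal_ofReal hs]
  exact hM.survival_mul_add_setLIntegral_growthBound_le π hx hT hs

end Step

section Supermartingale

variable {S : Type*} {w : S → ℝ} {ρ b : ℝ}

/-- The growth bound for the path frozen after its `k`-th jump, evaluated at the time left until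
`t`. This is zero if `t < T_k`, by truncated subtraction, and then only the weight of `ξ_t` is
left. As a process in `k` it is a supermartingale. -/
noncomputable def stoppedGrowthBound (ρ b : ℝ) (w : S → ℝ) (t : ℝ≥0) (k : ℕ) (ω : Path S) :
    ℝ≥0∞ :=
  extGrowthBound ρ b w (t - jumpTime k ω) (state t (freeze k ω))

theorem stoppedGrowthBound_zero (t : ℝ≥0) (ω : Path S) :
    stoppedGrowthBound ρ b w t 0 ω = extGrowthBound ρ b w t (mark 0 ω) := by
  rw [stoppedGrowthBound, state_freeze_of_jumpTime_le (by simp [jumpTime_zero]), jumpTime_zero,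
    tsub_zero]

theorem stoppedGrowthBound_of_jumpTime_le {t : ℝ≥0} {k : ℕ} {ω : Path S}
    (h : jumpTime k ω ≤ t) :
    stoppedGrowthBound ρ b w t k ω = extGrowthBound ρ b w (t - jumpTime k ω) (mark k ω) := by
  rw [stoppedGrowthBound, state_freeze_of_jumpTime_le h]

theorem stoppedGrowthBound_of_lt_jumpTime {t : ℝ≥0} {k : ℕ} {ω : Path S}
    (h : t < jumpTime k ω) :
    stoppedGrowthBound ρ b w t k ω = extWeight w (state t ω) := by
  have hstate : state t (freeze k ω) = state t ω :=
    state_freeze_of_lt_jumpTime (h.trans_le (jumpTime_mono ω k.le_succ))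
  rw [stoppedGrowthBound, tsub_eq_zero_of_le h.le, extGrowthBound_zero, hstate]

theorem stoppedGrowthBound_succ (t : ℝ≥0) (k : ℕ) (ω : Path S) :
    stoppedGrowthBound ρ b w t (k + 1) ω =
      extGrowthBound ρ b w (t - (jumpTime k ω + sojourn (k + 1) ω))
        (if t < jumpTime k ω + sojourn (k + 1) ω then state t (freeze k ω)
          else mark (k + 1) ω) := by
  rw [← jumpTime_succ]
  split_ifs with h
  · rw [stoppedGrowthBound_of_lt_jumpTime h, state_freeze_of_lt_jumpTime h,
      tsub_eq_zero_of_le h.le, extGrowthBound_zero]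
  · exact stoppedGrowthBound_of_jumpTime_le (not_lt.1 h)

variable [MeasurableSpace S]

theorem measurable_stoppedGrowthBound (hw : Measurable w) (t : ℝ≥0) (k : ℕ) :
    Measurable fun ω => stoppedGrowthBound ρ b w t k ω :=
  ((measurable_extGrowthBound ρ b hw).comp ((measurable_const.sub (measurable_jumpTime k)).prodMk
    (measurable_state.comp ((measurable_freeze k).prodMk measurable_const))) :)

variable {A : Type*} [StandardBorelSpace S] [MeasurableSpace A] {M : CTMDP S A} (π : M.Policy)
  (γ : Measure S) [IsProbabilityMeasure γ]

theorem setLIntegral_law_step (k : ℕ) {B : Set (Path S)} (hB : MeasurableSet B)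
    {H : Path S × (ℝ≥0∞ × (S ⊕ Unit)) → ℝ≥0∞} (hH : Measurable H) :
    ∫⁻ ω in freeze k ⁻¹' B, H (freeze k ω, ω.1 (k + 1)) ∂law π γ =
      ∫⁻ ω in freeze k ⁻¹' B, ∫⁻ e, H (freeze k ω, e) ∂stepMeasure π k ω ∂law π γ := by
  let κ : Kernel (Path S) (ℝ≥0∞ × (S ⊕ Unit)) := ⟨stepMeasure π k, measurable_stepMeasure π k⟩
  have hmarkov : IsMarkovKernel κ := ⟨isProbabilityMeasure_stepMeasure π k⟩
  have hfreeze := measurable_freeze (S := S) k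
  have hpair : Measurable fun ω : Path S => (freeze k ω, ω.1 (k + 1)) :=
    hfreeze.prodMk ((measurable_pi_apply (k + 1)).comp measurable_subtype_coe)
  have hlaw : (law π γ).map (fun ω => (freeze k ω, ω.1 (k + 1))) =
      ((law π γ).map (freeze k)) ⊗ₘ κ := by
    refine Measure.ext_prod fun {B D} hB hD => ?_
    rw [Measure.map_apply hpair (hB.prod hD), Measure.compProd_apply_prod hB hD,
      setLIntegral_map hB (κ.measurable_coe hD) hfreeze]
    simp only [κ, Kernel.coe_mk, stepMeasure_freeze]
    exact law_step π γ k hB hD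
  have hpre : freeze k ⁻¹' B = (fun ω : Path S => (freeze k ω, ω.1 (k + 1))) ⁻¹'
      (B ×ˢ Set.univ) := by
    ext ω
    simp
  rw [hpre, ← setLIntegral_map (hB.prod .univ) hH hpair, hlaw,
    Measure.setLIntegral_compProd hH hB .univ,
    setLIntegral_map hB (by simpa using hH.lintegral_kernel_prod_right') hfreeze, ← hpre]
  simp only [κ, Kernel.coe_mk, stepMeasure_freeze, Measure.restrict_univ]

theorem DriftCondition.lintegral_stepMeasure_stoppedGrowthBound_le
    (hM : M.DriftCondition w ρ b) (t : ℝ≥0) (k : ℕ) (ω : Path S) :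
    ∫⁻ e, extGrowthBound ρ b w (t - (jumpTime k ω + e.1))
        (if t < jumpTime k ω + e.1 then state t (freeze k ω) else e.2) ∂stepMeasure π k ω ≤
      stoppedGrowthBound ρ b w t k ω := by
  rcases le_or_gt (jumpTime k ω) t with hle | hlt
  · obtain ⟨x, hx⟩ := mark_eq_inl_of_jumpTime_le hle
    have hT : jumpTime k ω ≠ ⊤ := ne_top_of_le_ne_top ENNReal.coe_ne_top hle
    rw [stoppedGrowthBound_of_jumpTime_le hle, state_freeze_of_jumpTime_le hle, hx]
    simpa only [tsub_add_eq_tsub_tsub, ENNReal.sub_lt_iff_lt_left hT hle] using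
      hM.lintegral_stepMeasure_extGrowthBound_le π hx hT
        (ENNReal.sub_ne_top (ENNReal.coe_ne_top (r := t)) (b := jumpTime k ω))
  · have hprob := isProbabilityMeasure_stepMeasure π k ω
    have hlt' : ∀ s, (t : ℝ≥0∞) < jumpTime k ω + s := fun s => hlt.trans_le le_self_add
    simp only [if_pos (hlt' _), tsub_eq_zero_of_le (hlt' _).le, lintegral_const, measure_univ,
      mul_one, stoppedGrowthBound, tsub_eq_zero_of_le hlt.le, le_rfl]

theorem DriftCondition.setLIntegral_stoppedGrowthBound_succ_le (hM : M.DriftCondition w ρ b)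
    (t : ℝ≥0) (k : ℕ) {B : Set (S ⊕ Unit)} (hB : MeasurableSet B) :
    ∫⁻ ω in mark 0 ⁻¹' B, stoppedGrowthBound ρ b w t (k + 1) ω ∂law π γ ≤
      ∫⁻ ω in mark 0 ⁻¹' B, stoppedGrowthBound ρ b w t k ω ∂law π γ := by
  let H : Path S × (ℝ≥0∞ × (S ⊕ Unit)) → ℝ≥0∞ := fun p =>
    extGrowthBound ρ b w (t - (jumpTime k p.1 + p.2.1))
      (if t < jumpTime k p.1 + p.2.1 then state t p.1 else p.2.2)
  have htime : Measurable fun p : Path S × (ℝ≥0∞ × (S ⊕ Unit)) => jumpTime k p.1 + p.2.1 :=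
    ((measurable_jumpTime k).comp measurable_fst).add measurable_snd.fst
  have hstate : Measurable fun p : Path S × (ℝ≥0∞ × (S ⊕ Unit)) => state t p.1 :=
    measurable_state.comp (measurable_fst.prodMk measurable_const)
  have hH : Measurable H := ((measurable_extGrowthBound ρ b hM.measurable_w).comp
    ((measurable_const.sub htime).prodMk
      (Measurable.ite (measurableSet_lt measurable_const htime) hstate measurable_snd.snd)) :)
  have hsucc : ∀ ω : Path S,
      stoppedGrowthBound ρ b w t (k + 1) ω = H (freeze k ω, ω.1 (k + 1)) := fun ω => by
    simp only [H, jumpTime_freeze le_rfl]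
    exact stoppedGrowthBound_succ t k ω
  have hpre : mark 0 ⁻¹' B = freeze k ⁻¹' (mark 0 ⁻¹' B) := by
    ext ω
    simp only [Set.mem_preimage, mark_freeze (Nat.zero_le k)]
  simp_rw [hsucc]
  rw [hpre, setLIntegral_law_step π γ k (measurable_mark 0 hB) hH]
  refine lintegral_mono fun ω => ?_
  simpa only [H, jumpTime_freeze le_rfl] using
    hM.lintegral_stepMeasure_stoppedGrowthBound_le π t k ω

theorem DriftCondition.setLIntegral_stoppedGrowthBound_le (hM : M.DriftCondition w ρ b)
    (t : ℝ≥0) (n : ℕ) {B : Set S} (hB : MeasurableSet B) :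
    ∫⁻ ω in mark 0 ⁻¹' (Sum.inl '' B), stoppedGrowthBound ρ b w t n ω ∂law π γ ≤
      ∫⁻ x in B, ENNReal.ofReal (growthBound ρ b t (w x)) ∂γ := by
  have hB' : MeasurableSet (Sum.inl '' B : Set (S ⊕ Unit)) := measurableSet_inl_image.2 hB
  induction n with
  | zero =>
    have hG : Measurable fun z : S ⊕ Unit => extGrowthBound ρ b w t z :=
      ((measurable_extGrowthBound ρ b hM.measurable_w).comp measurable_prodMk_left :)
    simp_rw [stoppedGrowthBound_zero]
    rw [← setLIntegral_map hB' hG (measurable_mark 0), law_map_mark_zero,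
      setLIntegral_map hB' hG measurable_inl, Set.preimage_image_eq _ Sum.inl_injective]
    exact le_rfl
  | succ n ih => exact (hM.setLIntegral_stoppedGrowthBound_succ_le π γ t n hB').trans ih

end Supermartingale

section Nonexplosion

theorem extWeight_state_le_liminf {S : Type*} (ρ b : ℝ) (w : S → ℝ) (t : ℝ≥0) (ω : Path S) :
    extWeight w (state t ω) ≤ liminf (fun n => stoppedGrowthBound ρ b w t n ω) atTop := by
  by_cases h : ∃ n, (t : ℝ≥0∞) < jumpTime n ω
  · obtain ⟨n, hn⟩ := h
    refine le_liminf_of_le (by isBoundedDefault) ?_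
    filter_upwards [eventually_ge_atTop n] with m hm
    exact (stoppedGrowthBound_of_lt_jumpTime (hn.trans_le (jumpTime_mono ω hm))).ge
  · have hstate : state t ω = Sum.inr () := dif_neg fun ⟨m, hm⟩ => h ⟨m + 1, hm.2⟩
    simp [hstate, extWeight]

variable {S A : Type*} [MeasurableSpace S] [StandardBorelSpace S] [MeasurableSpace A]
  {M : CTMDP S A} {w : S → ℝ} {ρ b : ℝ} (π : M.Policy) (γ : Measure S) [IsProbabilityMeasure γ]

theorem DriftCondition.lintegral_extWeight_state_le (hM : M.DriftCondition w ρ b) (t : ℝ≥0) :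
    ∫⁻ ω, extWeight w (state t ω) ∂law π γ ≤
      ∫⁻ x, ENNReal.ofReal (growthBound ρ b t (w x)) ∂γ := by
  have huniv : (mark 0 ⁻¹' (Sum.inl '' Set.univ) : Set (Path S)) = Set.univ :=
    Set.eq_univ_of_forall fun ω => Set.image_univ ▸ ω.2.2.1
  have hbound : ∀ n, ∫⁻ ω, stoppedGrowthBound ρ b w t n ω ∂law π γ ≤
      ∫⁻ x, ENNReal.ofReal (growthBound ρ b t (w x)) ∂γ := fun n => by
    simpa only [huniv, Measure.restrict_univ] using
      hM.setLIntegral_stoppedGrowthBound_le π γ t n MeasurableSet.univ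
  calc ∫⁻ ω, extWeight w (state t ω) ∂law π γ
      ≤ ∫⁻ ω, liminf (fun n => stoppedGrowthBound ρ b w t n ω) atTop ∂law π γ :=
        lintegral_mono fun ω => extWeight_state_le_liminf ρ b w t ω
    _ ≤ liminf (fun n => ∫⁻ ω, stoppedGrowthBound ρ b w t n ω ∂law π γ) atTop :=
        lintegral_liminf_le fun n => measurable_stoppedGrowthBound hM.measurable_w t n
    _ ≤ ∫⁻ x, ENNReal.ofReal (growthBound ρ b t (w x)) ∂γ :=
        liminf_le_of_le (by isBoundedDefault) fun c hc =>
          let ⟨n, hn⟩ := hc.exists; hn.trans (hbound n)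

theorem tsum_law_one_lt_sojourn_le (t : ℝ≥0) :
    ∑' n, law π γ {ω | jumpTime n ω ≤ t ∧ 1 < sojourn (n + 1) ω} ≤ t + 1 := by
  have hmeas : ∀ n, MeasurableSet {ω : Path S | jumpTime n ω ≤ t ∧ 1 < sojourn (n + 1) ω} :=
    fun n => (measurable_jumpTime n measurableSet_Iic).inter
      (measurable_sojourn (n + 1) measurableSet_Ioi)
  refine ENNReal.tsum_le_of_sum_range_le fun n => ?_
  simp_rw [← lintegral_indicator_one (hmeas _)]
  rw [← lintegral_finsetSum _ fun m _ => measurable_one.indicator (hmeas m)]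
  calc _ ≤ ∫⁻ _, (t + 1 : ℝ≥0∞) ∂law π γ := lintegral_mono fun ω =>
        (sum_indicator_one_lt_sojourn_le t ω n).trans (min_le_right _ _)
    _ = t + 1 := by simp

theorem exp_neg_mul_law_mark_mem_le (t : ℝ≥0) (n : ℕ) {B : Set S} (hB : MeasurableSet B) :
    EReal.exp (-((⨆ x ∈ B, M.maxRate x : ℝ≥0∞) : EReal)) *
        law π γ {ω | jumpTime n ω ≤ t ∧ mark n ω ∈ Sum.inl '' B} ≤
      law π γ {ω | jumpTime n ω ≤ t ∧ 1 < sojourn (n + 1) ω} := by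
  have hT : MeasurableSet {ω : Path S | jumpTime n ω ≤ t} :=
    measurable_jumpTime n measurableSet_Iic
  have hmeas : MeasurableSet {ω : Path S | jumpTime n ω ≤ t ∧ mark n ω ∈ Sum.inl '' B} :=
    hT.inter (measurable_mark n (measurableSet_inl_image.2 hB))
  have hstep := law_step π γ n hT (D := {e | ENNReal.ofReal 1 < e.1})
    (measurable_fst measurableSet_Ioi)
  simp only [Set.mem_ofPred_eq, Set.preimage_ofPred_eq, jumpTime_freeze le_rfl] at hstep
  rw [ENNReal.ofReal_one] at hstep
  change law π γ {ω | jumpTime n ω ≤ t ∧ 1 < sojourn (n + 1) ω} = _ at hstep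
  rw [hstep, ← setLIntegral_const]
  refine (setLIntegral_mono' hmeas fun ω hω => ?_).trans (lintegral_mono_set fun ω hω => hω.1)
  obtain ⟨hωt, x, hx, hxm⟩ := hω
  have hθ : sojourn n ω ≠ ⊤ :=
    ne_top_of_le_ne_top ENNReal.coe_ne_top ((sojourn_le_jumpTime n ω).trans hωt)
  rw [← ENNReal.ofReal_one, stepMeasure_lt π hθ zero_le_one]
  refine le_trans (EReal.exp_monotone (EReal.neg_le_neg_iff.2
    (EReal.coe_ennreal_le_coe_ennreal_iff.2 ?_))) (exp_neg_maxRate_le_survival π hxm.symm)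
  exact le_iSup₂ (f := fun x (_ : x ∈ B) => M.maxRate x) x hx

/-- Every visit to `B` is followed by a sojourn longer than one with probability at least
`exp (- sup_B q̄)`, and at most `t + 1` such sojourns can start before time `t`. -/
theorem tsum_law_mark_mem_ne_top (t : ℝ≥0) {B : Set S} (hB : MeasurableSet B)
    (hrate : (⨆ x ∈ B, M.maxRate x) < ⊤) :
    ∑' n, law π γ {ω | jumpTime n ω ≤ t ∧ mark n ω ∈ Sum.inl '' B} ≠ ⊤ := by
  have hε : EReal.exp (-((⨆ x ∈ B, M.maxRate x : ℝ≥0∞) : EReal)) ≠ 0 := by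
    simpa only [ne_eq, EReal.exp_eq_zero_iff, EReal.neg_eq_bot_iff,
      EReal.coe_ennreal_eq_top_iff] using hrate.ne
  have hsum := (ENNReal.tsum_le_tsum fun n => exp_neg_mul_law_mark_mem_le π γ t n hB).trans
    (tsum_law_one_lt_sojourn_le π γ t)
  intro htop
  rw [ENNReal.tsum_mul_left, htop, ENNReal.mul_top hε] at hsum
  exact absurd hsum (by simp)

theorem DriftCondition.mul_law_mark_mem_le (hM : M.DriftCondition w ρ b) (t : ℝ≥0) (n : ℕ)
    {B D : Set S} (hB : MeasurableSet B) (hD : MeasurableSet D) {R : ℝ} (hR : ∀ x ∈ D, R ≤ w x) :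
    ENNReal.ofReal R * law π γ (mark 0 ⁻¹' (Sum.inl '' B) ∩
        {ω | jumpTime n ω ≤ t ∧ mark n ω ∈ Sum.inl '' D}) ≤
      ∫⁻ x in B, ENNReal.ofReal (growthBound ρ b t (w x)) ∂γ := by
  have hmeas : MeasurableSet (mark 0 ⁻¹' (Sum.inl '' B) ∩
      {ω : Path S | jumpTime n ω ≤ t ∧ mark n ω ∈ Sum.inl '' D}) :=
    (measurable_mark 0 (measurableSet_inl_image.2 hB)).inter
      ((measurable_jumpTime n measurableSet_Iic).inter
        (measurable_mark n (measurableSet_inl_image.2 hD)))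
  refine le_trans ?_ (hM.setLIntegral_stoppedGrowthBound_le π γ t n hB)
  rw [← setLIntegral_const]
  refine (setLIntegral_mono' hmeas fun ω hω => ?_).trans
    (lintegral_mono_set Set.inter_subset_left)
  obtain ⟨-, hωt, x, hx, hxm⟩ := hω
  rw [stoppedGrowthBound_of_jumpTime_le hωt, ← hxm]
  exact (ENNReal.ofReal_le_ofReal (hR x hx)).trans
    (hM.extWeight_le_extGrowthBound _ (Sum.inl x))

theorem DriftCondition.mul_law_forall_jumpTime_le (hM : M.DriftCondition w ρ b) (t : ℝ≥0)
    {B D : Set S} (hB : MeasurableSet B) (hD : MeasurableSet D)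
    (hrate : (⨆ x ∈ D, M.maxRate x) < ⊤) {R : ℝ} (hR : ∀ x ∉ D, R ≤ w x) :
    ENNReal.ofReal R * law π γ {ω | mark 0 ω ∈ Sum.inl '' B ∧ ∀ n, jumpTime n ω ≤ t} ≤
      ∫⁻ x in B, ENNReal.ofReal (growthBound ρ b t (w x)) ∂γ := by
  set K := ∫⁻ x in B, ENNReal.ofReal (growthBound ρ b t (w x)) ∂γ
  have hvisits := ENNReal.tendsto_atTop_zero_of_tsum_ne_top
    (tsum_law_mark_mem_ne_top π γ t hD hrate)
  have hlim : Tendsto (fun n => ENNReal.ofReal R *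
      law π γ {ω | jumpTime n ω ≤ t ∧ mark n ω ∈ Sum.inl '' D} + K) atTop (𝓝 K) := by
    simpa using (ENNReal.Tendsto.const_mul hvisits (Or.inr ENNReal.ofReal_ne_top)).add_const K
  refine ge_of_tendsto' hlim fun n => ?_
  have hsub : {ω : Path S | mark 0 ω ∈ Sum.inl '' B ∧ ∀ n, jumpTime n ω ≤ t} ⊆
      {ω | jumpTime n ω ≤ t ∧ mark n ω ∈ Sum.inl '' D} ∪ (mark 0 ⁻¹' (Sum.inl '' B) ∩
        {ω | jumpTime n ω ≤ t ∧ mark n ω ∈ Sum.inl '' Dᶜ}) := by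
    rintro ω ⟨h0, hT⟩
    obtain ⟨x, hx⟩ := mark_eq_inl_of_jumpTime_le (hT n)
    by_cases hxD : x ∈ D
    · exact Or.inl ⟨hT n, x, hxD, hx.symm⟩
    · exact Or.inr ⟨h0, hT n, x, hxD, hx.symm⟩
  refine (mul_le_mul_right ((measure_mono hsub).trans (measure_union_le _ _)) _).trans ?_
  rw [mul_add]
  exact add_le_add le_rfl (hM.mul_law_mark_mem_le π γ t n hB hD.compl hR)

theorem DriftCondition.law_forall_jumpTime_le_eq_zero (hM : M.DriftCondition w ρ b)
    (hexh : ∀ R : ℝ, ∃ D, MeasurableSet D ∧ (⨆ x ∈ D, M.maxRate x) < ⊤ ∧ ∀ x ∉ D, R ≤ w x)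
    (t : ℝ≥0) (N : ℝ) :
    law π γ {ω | mark 0 ω ∈ Sum.inl '' {x | w x ≤ N} ∧ ∀ n, jumpTime n ω ≤ t} = 0 := by
  have hB : MeasurableSet {x | w x ≤ N} := hM.measurable_w measurableSet_Iic
  have hfinite : ∫⁻ x in {x | w x ≤ N}, ENNReal.ofReal (growthBound ρ b t (w x)) ∂γ ≠ ⊤ := by
    refine ne_top_of_le_ne_top ?_ (setLIntegral_mono' hB fun x hx => ENNReal.ofReal_le_ofReal
      (q := growthBound ρ b t N) ?_)
    · rw [setLIntegral_const]
      exact ENNReal.mul_ne_top ENNReal.ofReal_ne_top (measure_ne_top _ _)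
    · have hxN : w x ≤ N := hx
      rw [growthBound_eq_exp_mul_add ρ b t (w x), growthBound_eq_exp_mul_add ρ b t N]
      gcongr
  by_contra hpos
  obtain ⟨R, hR⟩ := ENNReal.exists_nat_mul_gt hpos hfinite
  obtain ⟨D, hD, hrate, hRw⟩ := hexh R
  refine absurd (hM.mul_law_forall_jumpTime_le π γ t hB hD hrate hRw) (not_le.2 ?_)
  rwa [ENNReal.ofReal_natCast]

theorem DriftCondition.ae_explosionTime_eq_top (hM : M.DriftCondition w ρ b)
    (hexh : ∀ R : ℝ, ∃ D, MeasurableSet D ∧ (⨆ x ∈ D, M.maxRate x) < ⊤ ∧ ∀ x ∉ D, R ≤ w x) :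
    ∀ᵐ ω ∂law π γ, explosionTime ω = ⊤ := by
  have hnull : ∀ᵐ ω ∂law π γ, ∀ t N : ℕ,
      ¬(mark 0 ω ∈ Sum.inl '' {x | w x ≤ N} ∧ ∀ n, jumpTime n ω ≤ (t : ℝ≥0)) :=
    ae_all_iff.2 fun t => ae_all_iff.2 fun N =>
      measure_eq_zero_iff_ae_notMem.1 (hM.law_forall_jumpTime_le_eq_zero π γ hexh t N)
  filter_upwards [hnull] with ω hω
  by_contra hne
  obtain ⟨t, ht⟩ := ENNReal.exists_nat_gt hne
  obtain ⟨x, hx⟩ := ω.2.2.1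
  obtain ⟨N, hN⟩ := exists_nat_ge (w x)
  exact hω t N ⟨⟨x, hN, hx⟩, fun n => (le_iSup (fun n => jumpTime n ω) n).trans
    (ht.le.trans_eq (by simp))⟩

end Nonexplosion

section EIntegral

variable {X : Type*} [MeasurableSpace X] (μ : Measure X) (f : X → EReal)

theorem neg_lintegral_le_eintegral :
    -((∫⁻ x, (-f x).toENNReal ∂μ : ℝ≥0∞) : EReal) ≤ eintegral μ f := by
  rw [eintegral, sub_eq_add_neg]
  exact le_add_of_nonneg_left (EReal.coe_ennreal_nonneg _)

theorem toENNReal_neg_eintegral_le :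
    (-eintegral μ f).toENNReal ≤ ∫⁻ x, (-f x).toENNReal ∂μ := by
  refine (EReal.toENNReal_le_toENNReal
    (EReal.neg_le_neg_iff.2 (neg_lintegral_le_eintegral μ f))).trans ?_
  rw [neg_neg, EReal.toENNReal_coe]

end EIntegral

section Cost

variable {S A : Type*} [MeasurableSpace S] [MeasurableSpace A] {M : CTMDP S A} {w : S → ℝ}
  {ρ b α C c : ℝ}

theorem neg_le_coe_abs (x : EReal) : -x ≤ (x.abs : EReal) := by
  induction x with
  | bot => simp
  | top => simp
  | coe x =>
    rw [EReal.abs_def, EReal.coe_ennreal_ofReal, max_eq_left (abs_nonneg x)]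
    exact_mod_cast neg_le_abs x

theorem CostCondition.neg_le_cost {γ : Measure S} (hC : M.CostCondition w ρ α γ C c)
    (hw : ∀ x, 0 ≤ w x) (x : S) (a : A) (ha : a ∈ M.adm x) :
    -(C * w x + c) ≤ M.cost x a := by
  have hbound : 0 ≤ C * w x + c := add_nonneg (mul_nonneg hC.C_nonneg (hw x)) hC.c_nonneg
  have hle : -(⨅ a ∈ M.adm x, (M.cost x a : EReal)) ≤ (C * w x + c : ℝ) := by
    calc -(⨅ a ∈ M.adm x, (M.cost x a : EReal))
        ≤ ((⨅ a ∈ M.adm x, (M.cost x a : EReal)).abs : EReal) := neg_le_coe_abs _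
      _ ≤ _ := by
        simpa only [EReal.coe_ennreal_ofReal, max_eq_left hbound] using
          EReal.coe_ennreal_le_coe_ennreal_iff.2 (hC.abs_iInf_cost_le x)
  have hinf : (⨅ a ∈ M.adm x, (M.cost x a : EReal)) ≤ M.cost x a := iInf₂_le a ha
  exact_mod_cast (EReal.neg_le.1 hle).trans hinf

theorem measurableEmbedding_inl : MeasurableEmbedding (Sum.inl : A → A ⊕ Unit) :=
  ⟨Sum.inl_injective, measurable_inl, fun _ hs => measurableSet_inl_image.2 hs⟩

theorem ae_comap_inl_policy_mem (π : M.Policy) {ω : Path S} {t : ℝ≥0} {x : S}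
    (hx : leftState t ω = Sum.inl x) :
    ∀ᵐ a ∂(π.toFun ω t).comap Sum.inl, a ∈ M.adm x := by
  change (π.toFun ω t).comap Sum.inl (M.adm x)ᶜ = 0
  rw [measurableEmbedding_inl.comap_apply]
  refine measure_mono_null ?_ (hx ▸ π.concentrated ω t)
  rintro _ ⟨a, ha, rfl⟩ ⟨a', ha', h⟩
  exact ha (Sum.inl_injective h ▸ ha')

theorem toENNReal_neg_costRate_le (hw : ∀ x, 0 ≤ w x) (hC : 0 ≤ C) (hc : 0 ≤ c)
    (hcost : ∀ x, ∀ a ∈ M.adm x, -(C * w x + c) ≤ M.cost x a) (π : M.Policy) (ω : Path S)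
    (t : ℝ≥0) :
    (-costRate π ω t).toENNReal ≤
      ENNReal.ofReal C * extWeight w (leftState t ω) + ENNReal.ofReal c := by
  rw [costRate]
  rcases hx : leftState t ω with x | x
  · have hprob := π.isProbabilityMeasure ω t
    have hmass : (π.toFun ω t).comap Sum.inl Set.univ ≤ 1 := by
      rw [measurableEmbedding_inl.comap_apply]
      exact prob_le_one
    calc _ ≤ ∫⁻ a, (-(M.cost x a : EReal)).toENNReal ∂(π.toFun ω t).comap Sum.inl :=
          toENNReal_neg_eintegral_le _ _
      _ ≤ ∫⁻ _, ENNReal.ofReal (C * w x + c) ∂(π.toFun ω t).comap Sum.inl :=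
          lintegral_mono_ae ((ae_comap_inl_policy_mem π hx).mono fun a ha =>
            ENNReal.ofReal_le_ofReal (neg_le.1 (hcost x a ha)))
      _ ≤ ENNReal.ofReal (C * w x + c) := by
          rw [lintegral_const]
          exact mul_le_of_le_one_right' hmass
      _ = ENNReal.ofReal C * extWeight w (Sum.inl x) + ENNReal.ofReal c := by
          rw [ENNReal.ofReal_add (mul_nonneg hC (hw x)) hc, ENNReal.ofReal_mul hC, extWeight,
            Sum.elim_inl]
  · simp

theorem toENNReal_neg_pathCost_le (hw : ∀ x, 0 ≤ w x) (hC : 0 ≤ C) (hc : 0 ≤ c)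
    (hcost : ∀ x, ∀ a ∈ M.adm x, -(C * w x + c) ≤ M.cost x a) (π : M.Policy) (α : ℝ)
    (ω : Path S) :
    (-eintegral (volume.restrict (Set.Ioi (0 : ℝ))) fun t =>
        (Real.exp (-α * t) : EReal) * costRate π ω t.toNNReal).toENNReal ≤
      ∫⁻ t in Set.Ioi (0 : ℝ), ENNReal.ofReal (Real.exp (-α * t)) *
        (ENNReal.ofReal C * extWeight w (state t.toNNReal ω) + ENNReal.ofReal c) := by
  have hcount : (Set.range fun m => (jumpTime m ω).toReal).Countable := Set.countable_range _
  refine (toENNReal_neg_eintegral_le _ _).trans (lintegral_mono_ae ?_)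
  filter_upwards [ae_restrict_mem measurableSet_Ioi,
    ae_restrict_of_ae (hcount.ae_notMem volume)] with t ht hjump
  have hstate : leftState t.toNNReal ω = state t.toNNReal ω := leftState_eq_state fun m hm =>
    hjump ⟨m, by simp [hm, (Set.mem_Ioi.1 ht).le]⟩
  rw [← hstate, ← mul_neg, EReal.toENNReal_mul (EReal.coe_nonneg.2 (Real.exp_pos _).le),
    EReal.toENNReal_of_ne_top (EReal.coe_ne_top _), EReal.toReal_coe]
  exact mul_le_mul_right (toENNReal_neg_costRate_le hw hC hc hcost π ω _) _

theorem lintegral_growthBound {γ : Measure S} [IsProbabilityMeasure γ] (hρ : 0 ≤ ρ)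
    (hb : 0 ≤ b) (hw : ∀ x, 0 ≤ w x) (hint : Integrable w γ) {t : ℝ} (ht : 0 ≤ t) :
    ∫⁻ x, ENNReal.ofReal (growthBound ρ b t (w x)) ∂γ =
      ENNReal.ofReal (growthBound ρ b t (∫ x, w x ∂γ)) := by
  have hint' : Integrable (fun x => Real.exp (ρ * t) * w x) γ := hint.const_mul _
  have hgrowth : (fun x => growthBound ρ b t (w x)) =
      fun x => Real.exp (ρ * t) * w x + growthBound ρ b t 0 :=
    funext fun x => growthBound_eq_exp_mul_add ρ b t (w x)
  rw [← ofReal_integral_eq_lintegral_ofReal (hgrowth ▸ hint'.add (integrable_const _))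
    (ae_of_all _ fun x => growthBound_nonneg hρ hb ht (hw x)), hgrowth,
    integral_add hint' (integrable_const _), integral_const_mul, integral_const,
    probReal_univ, one_smul, ← growthBound_eq_exp_mul_add]

theorem setLIntegral_exp_neg_mul (hα : 0 < α) :
    ∫⁻ t in Set.Ioi (0 : ℝ), ENNReal.ofReal (Real.exp (-α * t)) = ENNReal.ofReal (1 / α) := by
  have hint : IntegrableOn (fun t => Real.exp (-α * t)) (Set.Ioi 0) :=
    integrableOn_exp_mul_Ioi (neg_neg_iff_pos.2 hα) 0
  rw [← ofReal_integral_eq_lintegral_ofReal hint (ae_of_all _ fun t => (Real.exp_pos _).le),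
    integral_exp_mul_Ioi (neg_neg_iff_pos.2 hα)]
  simp

variable [StandardBorelSpace S] {γ : Measure S} [IsProbabilityMeasure γ]

theorem DriftCondition.lintegral_weighted_cost_le (hM : M.DriftCondition w ρ b) (π : M.Policy)
    (hint : Integrable w γ) (hα : ρ < α) :
    ∫⁻ ω, (∫⁻ t in Set.Ioi (0 : ℝ), ENNReal.ofReal (Real.exp (-α * t)) *
        (ENNReal.ofReal C * extWeight w (state t.toNNReal ω) + ENNReal.ofReal c)) ∂law π γ ≤
      ENNReal.ofReal C * ENNReal.ofReal ((α * (∫ x, w x ∂γ) + b) / (α * (α - ρ))) +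
        ENNReal.ofReal c * ENNReal.ofReal (1 / α) := by
  have hρ := hM.rho_nonneg
  have hb := hM.b_nonneg
  have hweight : Measurable fun p : Path S × ℝ => extWeight w (state p.2.toNNReal p.1) :=
    (measurable_extWeight hM.measurable_w).comp
      (measurable_state.comp (measurable_fst.prodMk measurable_snd.real_toNNReal))
  have hexp : Measurable fun t : ℝ => ENNReal.ofReal (Real.exp (-α * t)) := by fun_prop
  have hgrowth : ∀ t ∈ Set.Ioi (0 : ℝ), ∫⁻ ω, extWeight w (state t.toNNReal ω) ∂law π γ ≤
      ENNReal.ofReal (growthBound ρ b t (∫ x, w x ∂γ)) := fun t ht => by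
    refine (hM.lintegral_extWeight_state_le π γ t.toNNReal).trans_eq ?_
    rw [Real.coe_toNNReal t (le_of_lt ht),
      lintegral_growthBound hρ hb hM.w_nonneg hint (le_of_lt ht)]
  rw [lintegral_lintegral_swap ((hexp.comp measurable_snd).mul
    ((hweight.const_mul _).add_const _)).aemeasurable]
  calc _ ≤ ∫⁻ t in Set.Ioi (0 : ℝ), (ENNReal.ofReal C *
        ENNReal.ofReal (Real.exp (-α * t) * growthBound ρ b t (∫ x, w x ∂γ)) +
          ENNReal.ofReal c * ENNReal.ofReal (Real.exp (-α * t))) := by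
        refine setLIntegral_mono' measurableSet_Ioi fun t ht => ?_
        have hweight_t : Measurable fun ω : Path S => extWeight w (state t.toNNReal ω) :=
          hweight.comp measurable_prodMk_right
        rw [lintegral_const_mul _ ((hweight_t.const_mul _).add_const _),
          lintegral_add_right _ measurable_const, lintegral_const_mul _ hweight_t,
          lintegral_const, measure_univ, mul_one, ENNReal.ofReal_mul (Real.exp_pos _).le]
        grw [hgrowth t ht]
        exact le_of_eq (by ring)
    _ ≤ _ := by
        rw [lintegral_add_right _ (hexp.const_mul _),
          lintegral_const_mul' _ _ ENNReal.ofReal_ne_top,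
          lintegral_const_mul' _ _ ENNReal.ofReal_ne_top,
          setLIntegral_exp_neg_mul (hρ.trans_lt hα)]
        grw [setLIntegral_exp_mul_growthBound_le hρ hb hα (integral_nonneg hM.w_nonneg)]

theorem DriftCondition.le_discountedCost (hM : M.DriftCondition w ρ b) (π : M.Policy)
    (hint : Integrable w γ) (hα : ρ < α) (hC : 0 ≤ C) (hc : 0 ≤ c)
    (hcost : ∀ x, ∀ a ∈ M.adm x, -(C * w x + c) ≤ M.cost x a) :
    ((-(C * (α * (∫ x, w x ∂γ) + b) / (α * (α - ρ))) - c / α : ℝ) : EReal) ≤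
      discountedCost π γ α := by
  have hα0 : 0 < α := hM.rho_nonneg.trans_lt hα
  have hb := hM.b_nonneg
  have hW : 0 ≤ ∫ x, w x ∂γ := integral_nonneg hM.w_nonneg
  have hneg := (lintegral_mono fun ω =>
    toENNReal_neg_pathCost_le hM.w_nonneg hC hc hcost π α ω).trans
      (hM.lintegral_weighted_cost_le π hint hα)
  rw [← ENNReal.ofReal_mul hC, ← ENNReal.ofReal_mul hc,
    ← ENNReal.ofReal_add (by positivity) (by positivity)] at hneg
  refine le_trans (le_of_eq ?_) ((EReal.neg_le_neg_iff.2
    (EReal.coe_ennreal_le_coe_ennreal_iff.2 hneg)).trans (neg_lintegral_le_eintegral _ _))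
  rw [EReal.coe_ennreal_ofReal, max_eq_left (by positivity), ← EReal.coe_neg]
  congr 1
  ring

end Cost

end CTMDP

theorem theorem1_general {S A : Type*} [MeasurableSpace S] [StandardBorelSpace S]
    [MeasurableSpace A] {M : CTMDP S A} {w : S → ℝ} {ρ b : ℝ} (hM : M.DriftCondition w ρ b)
    (hexh : ∀ R : ℝ, ∃ D, MeasurableSet D ∧ (⨆ x ∈ D, M.maxRate x) < ⊤ ∧ ∀ x ∉ D, R ≤ w x)
    (π : M.Policy) :
    ((∀ (γ : Measure S) [IsProbabilityMeasure γ],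
        CTMDP.law π γ {ω | CTMDP.explosionTime ω = ⊤} = 1 ∧
          ∀ t : ℝ≥0, CTMDP.law π γ {ω | CTMDP.state t ω ∈ Set.range Sum.inl} = 1) ∧
      ∀ (x : S) (t : ℝ≥0),
        ∫⁻ ω, Sum.elim (fun y => ENNReal.ofReal (w y)) (fun _ => 0) (CTMDP.state t ω)
            ∂CTMDP.law π (Measure.dirac x) ≤
          ENNReal.ofReal (if ρ = 0 then w x + b * t
            else Real.exp (ρ * t) * w x + b / ρ * (Real.exp (ρ * t) - 1))) ∧
    ∀ (γ : Measure S) [IsProbabilityMeasure γ] (α C c : ℝ), Integrable w γ → ρ < α →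
      0 ≤ C → 0 ≤ c → (∀ x, ∀ a ∈ M.adm x, -(C * w x + c) ≤ M.cost x a) →
      ((-(C * (α * (∫ y, w y ∂γ) + b) / (α * (α - ρ))) - c / α : ℝ) : EReal) ≤
        CTMDP.discountedCost π γ α := by
  refine ⟨⟨fun γ _ => ?_, fun x t => ?_⟩, fun γ _ α C c => hM.le_discountedCost π⟩
  · have hexpl := hM.ae_explosionTime_eq_top π γ hexh
    have hstate : ∀ t, ∀ᵐ ω ∂CTMDP.law π γ, CTMDP.state t ω ∈ Set.range Sum.inl := fun t =>
      hexpl.mono fun ω hω => CTMDP.state_mem_range_inl hω t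
    exact ⟨(measure_congr (eventuallyEq_univ.2 hexpl)).trans measure_univ, fun t =>
      (measure_congr (eventuallyEq_univ.2 (hstate t))).trans measure_univ⟩
  · have hmeas : Measurable fun x => ENNReal.ofReal (CTMDP.growthBound ρ b t (w x)) :=
      ((CTMDP.continuous_growthBound ρ b).measurable.comp
        (measurable_const.prodMk hM.measurable_w)).ennreal_ofReal
    refine (hM.lintegral_extWeight_state_le π (Measure.dirac x) t).trans_eq ?_
    rw [lintegral_dirac' _ hmeas, CTMDP.growthBound]
    split_ifs with hρ <;> simp [hρ]

theorem theorem1 {S A : Type*} [MeasurableSpace S] [StandardBorelSpace S]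
    [MeasurableSpace A] [StandardBorelSpace A] (M : CTMDP S A)
    (w : S → ℝ) (ρ b : ℝ) (Sl : ℕ → Set S) (hL : M.LyapunovCondition w ρ b Sl) (π : M.Policy) :
    ((∀ (γ : Measure S) [IsProbabilityMeasure γ],
        CTMDP.law π γ {ω | CTMDP.explosionTime ω = ⊤} = 1 ∧
          ∀ t : ℝ≥0, CTMDP.law π γ {ω | CTMDP.state t ω ∈ Set.range Sum.inl} = 1) ∧
      ∀ (x : S) (t : ℝ≥0),
        ∫⁻ ω, Sum.elim (fun y => ENNReal.ofReal (w y)) (fun _ => 0) (CTMDP.state t ω)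
            ∂CTMDP.law π (Measure.dirac x) ≤
          ENNReal.ofReal (if ρ = 0 then w x + b * t
            else Real.exp (ρ * t) * w x + b / ρ * (Real.exp (ρ * t) - 1))) ∧
    ∀ (γ : Measure S) [IsProbabilityMeasure γ] (α C c : ℝ), M.CostCondition w ρ α γ C c →
      ((-(C * (α * (∫ y, w y ∂γ) + b) / (α * (α - ρ))) - c / α : ℝ) : EReal) ≤
        CTMDP.discountedCost π γ α := by
  have h := theorem1_general hL.driftCondition hL.exists_maxRate_lt_top_le_weight π
  exact ⟨h.1, fun γ _ α C c hC => h.2 γ α C c hC.integrable_w hC.rho_lt hC.C_nonneg hC.c_nonneg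
    (hC.neg_le_cost hL.driftCondition.w_nonneg)⟩
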